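/- Let $G$ be a topological group in the class $\mathscr S$, that is, a compactly generated, totally disconnected, locally compact group that is topologically simple and non-discrete. A \emph{locally normal} subgroup of $G$ is a compact subgroup whose normaliser in $G$ is open. Let $\mathcal{LN}(G)$ be the set of locally normal subgroups of $G$ modulo commensurability; let $0 \in \mathcal{LN}(G)$ be the class of the trivial subgroup and $\infty \in \mathcal{LN}(G)$ the class of the compact open subgroups. For $\alpha \in \mathcal{LN}(G)$ let $\alpha^\perp \in \mathcal{LN}(G)$ be the class of the centraliser $\mathrm C_U(K)$, where $U$ is a compact open subgroup of $G$ and $K$ is a representative of $\alpha$ that is a closed normal subgroup of $U$ (for $G \in \mathscr S$ this class depends only on $\alpha$). Let $\mathcal{LC}(G) = \{\alpha^\perp \mid \alpha \in \mathcal{LN}(G)\}$ be the centraliser lattice of $G$. If $\mathcal{LC}(G) \neq \{0, \infty\}$, then there is an element $g \in G$ whose contraction group $$\mathrm{con}(g) = \{x \in G \mid \lim_{n \to \infty} g^n x g^{-n} = e\}$$ is not closed in $G$. -/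

import Mathlib

open Filter Topology

/-- A topological group is compactly generated if it is generated, as an abstract group, by a
compact subset. -/
def IsCompactlyGeneratedGroup (G : Type*) [Group G] [TopologicalSpace G] : Prop :=
  ∃ S : Set G, IsCompact S ∧ Subgroup.closure S = ⊤

/-- A topological group is topologically simple if it is non-trivial and its only closed normal
subgroups are the trivial subgroup and the whole group. -/
def IsTopologicallySimpleGroup (G : Type*) [Group G] [TopologicalSpace G] : Prop :=
  Nontrivial G ∧ ∀ N : Subgroup G, N.Normal → IsClosed (N : Set G) → N = ⊥ ∨ N = ⊤

/-- The class `𝒮` of compactly generated locally compact groups that are totally disconnected,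
topologically simple and non-discrete. Totally disconnected spaces are `T₁`, so that the members
of this class are automatically Hausdorff. -/
class IsClassS (G : Type*) [Group G] [TopologicalSpace G] [IsTopologicalGroup G] : Prop extends
    LocallyCompactSpace G, TotallyDisconnectedSpace G where
  compactlyGenerated : IsCompactlyGeneratedGroup G
  topologicallySimple : IsTopologicallySimpleGroup G
  nondiscrete : ¬ DiscreteTopology G

/-- A locally normal subgroup of a topological group is a compact subgroup whose normaliser is
open. -/
structure LocallyNormalSubgroup (G : Type*) [Group G] [TopologicalSpace G] where
  toSubgroup : Subgroup G
  isCompact' : IsCompact (toSubgroup : Set G)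
  isOpen_normalizer' : IsOpen (Subgroup.normalizer (toSubgroup : Set G) : Set G)

namespace LocallyNormalSubgroup

section General

variable {G : Type*} [Group G] [TopologicalSpace G]

/-- Commensurability of locally normal subgroups, as an equivalence relation. -/
instance commensurableSetoid (G : Type*) [Group G] [TopologicalSpace G] :
    Setoid (LocallyNormalSubgroup G) where
  r K L := Subgroup.Commensurable K.toSubgroup L.toSubgroup
  iseqv := ⟨fun _ => Subgroup.Commensurable.refl _, fun h => h.symm, fun h h' => h.trans h'⟩

/-- The trivial subgroup is locally normal. -/
def trivial (G : Type*) [Group G] [TopologicalSpace G] : LocallyNormalSubgroup G where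
  toSubgroup := ⊥
  isCompact' := by simp
  isOpen_normalizer' := by
    rw [Subgroup.normalizer_eq_top]
    exact isOpen_univ

end General

variable {G : Type*} [Group G] [TopologicalSpace G] [IsTopologicalGroup G]

/-- Every compact subgroup normalised by an open subgroup is locally normal. -/
def ofLeNormalizer (K U : Subgroup G) (hK : IsCompact (K : Set G)) (hU : IsOpen (U : Set G))
    (h : U ≤ Subgroup.normalizer (K : Set G)) : LocallyNormalSubgroup G where
  toSubgroup := K
  isCompact' := hK
  isOpen_normalizer' := Subgroup.isOpen_mono h hU

/-- Every compact open subgroup is locally normal. -/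
def ofCompactOpen (U : Subgroup G) (hc : IsCompact (U : Set G)) (ho : IsOpen (U : Set G)) :
    LocallyNormalSubgroup G :=
  ofLeNormalizer U U hc ho Subgroup.le_normalizer

/-- The centraliser in `U` of a subgroup normalised by `U` is normalised by `U`. -/
theorem le_normalizer_inf_centralizer {G : Type*} [Group G] {K U : Subgroup G}
    (h : U ≤ Subgroup.normalizer (K : Set G)) :
    U ≤ Subgroup.normalizer ((U ⊓ Subgroup.centralizer (K : Set G) : Subgroup G) : Set G) := by
  have key : ∀ g ∈ U, ∀ x ∈ U ⊓ Subgroup.centralizer (K : Set G),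
      g * x * g⁻¹ ∈ U ⊓ Subgroup.centralizer (K : Set G) := by
    rintro g hg x ⟨hxU, hxC⟩
    refine ⟨U.mul_mem (U.mul_mem hg hxU) (U.inv_mem hg), ?_⟩
    replace hxC := Subgroup.mem_centralizer_iff.1 hxC
    refine Subgroup.mem_centralizer_iff.2 ?_
    intro k hk
    have h1 : g⁻¹ * k * g ∈ K := by
      have := (Subgroup.mem_normalizer_iff.1 (h (U.inv_mem hg)) k).1 hk
      simpa using this
    have h2 := hxC _ h1
    calc k * (g * x * g⁻¹) = g * ((g⁻¹ * k * g) * x) * g⁻¹ := by group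
      _ = g * (x * (g⁻¹ * k * g)) * g⁻¹ := by rw [h2]
      _ = g * x * g⁻¹ * k := by group
  intro g hg
  rw [Subgroup.mem_normalizer_iff]
  refine fun x => ⟨key g hg x, fun hx => ?_⟩
  have := key g⁻¹ (U.inv_mem hg) _ hx
  simpa [mul_assoc] using this

/-- For a compact open subgroup `U` and a subgroup `K` normalised by `U`, the centraliser
`C_U(K)` as a locally normal subgroup. -/
def centralizerIn [T2Space G] (U K : Subgroup G) (hc : IsCompact (U : Set G))
    (ho : IsOpen (U : Set G)) (h : U ≤ Subgroup.normalizer (K : Set G)) :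
    LocallyNormalSubgroup G :=
  ofLeNormalizer (U ⊓ Subgroup.centralizer (K : Set G)) U
    (hc.inter_right (Set.isClosed_centralizer (K : Set G))) ho (le_normalizer_inf_centralizer h)

end LocallyNormalSubgroup

/-- The underlying set of the structure lattice `ℒ𝒩(G)`: the locally normal subgroups of `G`
modulo commensurability. -/
def StructureLattice (G : Type*) [Group G] [TopologicalSpace G] : Type _ :=
  Quotient (LocallyNormalSubgroup.commensurableSetoid G)

/-- Two compact open subgroups of a topological group are commensurable. -/
theorem commensurable_of_compact_open {G : Type*} [Group G] [TopologicalSpace G]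
    [IsTopologicalGroup G] {U V : Subgroup G} (hUc : IsCompact (U : Set G))
    (hUo : IsOpen (U : Set G)) (hVc : IsCompact (V : Set G)) (hVo : IsOpen (V : Set G)) :
    Subgroup.Commensurable U V := by
  have key : ∀ A B : Subgroup G, IsOpen (A : Set G) → IsCompact (B : Set G) →
      A.relIndex B ≠ 0 := by
    intro A B hA hB
    have : CompactSpace B := isCompact_iff_compactSpace.1 hB
    have ho : IsOpen ((A.subgroupOf B : Subgroup B) : Set B) := hA.preimage continuous_subtype_val
    have := Subgroup.quotient_finite_of_isOpen (A.subgroupOf B) ho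
    exact Subgroup.index_ne_zero_of_finite
  exact ⟨key U V hUo hVc, key V U hVo hUc⟩

/-- A totally disconnected locally compact group has a compact open subgroup. -/
theorem exists_compact_open_subgroup (G : Type*) [Group G] [TopologicalSpace G]
    [IsTopologicalGroup G] [LocallyCompactSpace G] [TotallyDisconnectedSpace G] :
    ∃ U : Subgroup G, IsCompact (U : Set G) ∧ IsOpen (U : Set G) := by
  obtain ⟨C, hC, hC1⟩ := exists_compact_mem_nhds (1 : G)
  obtain ⟨W, hW, h1W, hWC⟩ :=
    (loc_compact_Haus_tot_disc_of_zero_dim (H := G)).mem_nhds_iff.1 hC1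
  have hW : IsClopen W := hW
  have hWc : IsCompact W := hC.of_isClosed_subset hW.1 hWC
  obtain ⟨V, hV, hWV⟩ := compact_open_separated_mul_right hWc hW.2 subset_rfl
  let U : Subgroup G :=
    { carrier := {g | (∀ w ∈ W, w * g ∈ W) ∧ ∀ w ∈ W, w * g⁻¹ ∈ W}
      mul_mem' := by
        rintro a b ⟨ha, ha'⟩ ⟨hb, hb'⟩
        refine ⟨fun w hw => ?_, fun w hw => ?_⟩
        · rw [← mul_assoc]; exact hb _ (ha _ hw)
        · rw [mul_inv_rev, ← mul_assoc]; exact ha' _ (hb' _ hw)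
      one_mem' := by simp
      inv_mem' := by
        rintro a ⟨ha, ha'⟩
        exact ⟨ha', by simpa using ha⟩ }
  have hUW : (U : Set G) ⊆ W := fun g hg => by simpa using hg.1 1 h1W
  have hUo : IsOpen (U : Set G) := by
    refine Subgroup.isOpen_of_mem_nhds U (g := 1) ?_
    filter_upwards [hV, inv_mem_nhds_one G hV] with g hg hg'
    exact ⟨fun w hw => hWV (Set.mul_mem_mul hw hg), fun w hw => hWV (Set.mul_mem_mul hw hg')⟩
  exact ⟨U, hWc.of_isClosed_subset (U.isClosed_of_isOpen hUo) hUW, hUo⟩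

namespace StructureLattice

/-- The class of a locally normal subgroup. -/
def mk {G : Type*} [Group G] [TopologicalSpace G] (K : LocallyNormalSubgroup G) :
    StructureLattice G :=
  Quotient.mk _ K

/-- The element `0` of `ℒ𝒩(G)`: the class of the trivial subgroup. -/
def zero (G : Type*) [Group G] [TopologicalSpace G] : StructureLattice G :=
  mk (LocallyNormalSubgroup.trivial G)

section

variable {G : Type*} [Group G] [TopologicalSpace G] [IsTopologicalGroup G]
  [LocallyCompactSpace G] [TotallyDisconnectedSpace G]

/-- The element `∞` of `ℒ𝒩(G)`: the common class of all compact open subgroups, see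
`StructureLattice.mk_ofCompactOpen`. -/
noncomputable def infty (G : Type*) [Group G] [TopologicalSpace G] [IsTopologicalGroup G]
    [LocallyCompactSpace G] [TotallyDisconnectedSpace G] : StructureLattice G :=
  mk (LocallyNormalSubgroup.ofCompactOpen (exists_compact_open_subgroup G).choose
    (exists_compact_open_subgroup G).choose_spec.1 (exists_compact_open_subgroup G).choose_spec.2)

theorem mk_ofCompactOpen (U : Subgroup G) (hc : IsCompact (U : Set G))
    (ho : IsOpen (U : Set G)) :
    mk (LocallyNormalSubgroup.ofCompactOpen U hc ho) = infty G :=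
  Quotient.sound (commensurable_of_compact_open hc ho
    (exists_compact_open_subgroup G).choose_spec.1 (exists_compact_open_subgroup G).choose_spec.2)

/-- `IsPerp α β` says that `β = α^⊥`: some representative `K` of `α` is contained in and
normalised by some compact open subgroup `U`, and `β` is the class of `C_U(K)`. For `G` in the
class `𝒮` the class of `C_U(K)` depends only on `α`, so that this is the graph of the
operator `⊥`. -/
def IsPerp (α β : StructureLattice G) : Prop :=
  ∃ (K : LocallyNormalSubgroup G) (U : Subgroup G) (hc : IsCompact (U : Set G))
    (ho : IsOpen (U : Set G)) (_ : K.toSubgroup ≤ U)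
    (hn : U ≤ Subgroup.normalizer (K.toSubgroup : Set G)),
    α = mk K ∧ β = mk (LocallyNormalSubgroup.centralizerIn U K.toSubgroup hc ho hn)

end

end StructureLattice

/-- The underlying set of the centraliser lattice, `ℒ𝒞(G) = {α^⊥ | α ∈ ℒ𝒩(G)}`. -/
def centralizerLattice (G : Type*) [Group G] [TopologicalSpace G] [IsTopologicalGroup G]
    [LocallyCompactSpace G] [TotallyDisconnectedSpace G] : Set (StructureLattice G) :=
  {β | ∃ α, StructureLattice.IsPerp α β}

/-- The contraction group `con(g) = {x | g ^ n * x * g ^ (-n) → 1 as n → ∞}`. -/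
def contractionGroup {G : Type*} [Group G] [TopologicalSpace G] [IsTopologicalGroup G] (g : G) :
    Subgroup G where
  carrier := {x | Tendsto (fun n : ℕ => g ^ n * x * (g ^ n)⁻¹) atTop (𝓝 1)}
  mul_mem' := by
    intro a b ha hb
    have := Tendsto.mul ha hb
    simpa [mul_assoc] using this
  one_mem' := by simp [tendsto_const_nhds]
  inv_mem' := by
    intro a ha
    have := Tendsto.inv ha
    simpa [mul_assoc] using this

/-! Two facts about the class 𝒮 drive the proof: the quasi-centre is trivial
(`quasiCentralizer_top`), and no non-trivial locally normal subgroup is abelian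
(`noAbelianLocallyNormal`). They allow the elements of ℒ𝒞(G) to be represented by closed subgroups
equal to their double quasi-centraliser (`IsBicommutant`), so the lattice becomes a family of
subgroups permuted by conjugation.

If ℒ𝒞(G) is non-trivial, simplicity and compact generation produce an element g and a bicommutant δ
with gδg⁻¹ strictly inside δ, such that conjugation by g preserves membership in a compact open
subgroup U for elements of δ (`exists_skewering`). The part β of δ that quasi-centralises gδg⁻¹ is
non-trivial, and K = β ∩ U has translates gⁿKg⁻ⁿ, n ≥ 0, that stay in U and commute with one
another. A pigeonhole argument in U puts all commutators of K into con(g)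
(`commutator_mem_contractionGroup`).

Suppose con(g) is closed. It then contains the closure B of [K, K] and the closed subgroup P
generated by all gⁿBg⁻ⁿ. By Baire category and an index count, gPg⁻¹ is relatively open in P
(`eventually_inv_conj_mem`). But gPg⁻¹ centralises B, so a neighbourhood of 1 in B is central in B.
This forces B, then K, then β to be trivial, a contradiction. -/

set_option linter.unusedSectionVars false

/-! ### Conjugation of subgroups and stabilisers. -/

section ConjugateSubgroups

variable {G : Type*} [Group G]

/-- The conjugate `g H g⁻¹` of a subgroup. -/
def conjSubgroup (g : G) (H : Subgroup G) : Subgroup G :=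
  H.map (MulAut.conj g).toMonoidHom

theorem mem_conjSubgroup {g x : G} {H : Subgroup G} :
    x ∈ conjSubgroup g H ↔ g⁻¹ * x * g ∈ H := by
  constructor
  · rintro ⟨y, hy, rfl⟩
    simpa [mul_assoc] using hy
  · intro h
    exact ⟨_, h, by simp [mul_assoc]⟩

theorem conj_mem_conjSubgroup {g x : G} {H : Subgroup G} :
    g * x * g⁻¹ ∈ conjSubgroup g H ↔ x ∈ H := by
  simp [mem_conjSubgroup, mul_assoc]

theorem conjSubgroup_mul (g h : G) (H : Subgroup G) :
    conjSubgroup (g * h) H = conjSubgroup g (conjSubgroup h H) := by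
  ext x
  simp [mem_conjSubgroup, mul_assoc]

@[simp]
theorem conjSubgroup_one (H : Subgroup G) : conjSubgroup 1 H = H := by
  ext x
  simp [mem_conjSubgroup]

@[simp]
theorem conjSubgroup_inv_conjSubgroup (g : G) (H : Subgroup G) :
    conjSubgroup g⁻¹ (conjSubgroup g H) = H := by
  rw [← conjSubgroup_mul, inv_mul_cancel, conjSubgroup_one]

@[simp]
theorem conjSubgroup_conjSubgroup_inv (g : G) (H : Subgroup G) :
    conjSubgroup g (conjSubgroup g⁻¹ H) = H := by
  rw [← conjSubgroup_mul, mul_inv_cancel, conjSubgroup_one]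

theorem conjSubgroup_mono (g : G) {H K : Subgroup G} (h : H ≤ K) :
    conjSubgroup g H ≤ conjSubgroup g K :=
  Subgroup.map_mono h

theorem conjSubgroup_inf (g : G) (H K : Subgroup G) :
    conjSubgroup g (H ⊓ K) = conjSubgroup g H ⊓ conjSubgroup g K := by
  ext x
  simp [mem_conjSubgroup, Subgroup.mem_inf]

@[simp]
theorem conjSubgroup_bot (g : G) : conjSubgroup g (⊥ : Subgroup G) = ⊥ :=
  Subgroup.map_bot _

theorem conjSubgroup_injective (g : G) : Function.Injective (conjSubgroup g) := fun H K h => by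
  rw [← conjSubgroup_inv_conjSubgroup g H, h, conjSubgroup_inv_conjSubgroup]

theorem conjSubgroup_eq_bot {g : G} {H : Subgroup G} : conjSubgroup g H = ⊥ ↔ H = ⊥ := by
  rw [← (conjSubgroup_injective g).eq_iff (a := H), conjSubgroup_bot]

theorem conjSubgroup_sSup (g : G) (T : Set (Subgroup G)) :
    conjSubgroup g (sSup T) = sSup (conjSubgroup g '' T) := by
  rw [sSup_image, sSup_eq_iSup]
  simp only [conjSubgroup, Subgroup.map_iSup]

theorem normal_of_conjSubgroup_le {N : Subgroup G} (h : ∀ g, conjSubgroup g N ≤ N) :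
    N.Normal :=
  ⟨fun _ hn g => h g (conj_mem_conjSubgroup.2 hn)⟩

theorem conjSubgroup_eq_of_conj_mem {g : G} {H : Subgroup G} (h : ∀ x ∈ H, g * x * g⁻¹ ∈ H)
    (h' : ∀ x ∈ H, g⁻¹ * x * g ∈ H) : conjSubgroup g H = H := by
  ext x
  rw [mem_conjSubgroup]
  exact ⟨fun hx => by simpa [mul_assoc] using h _ hx, h' x⟩

theorem conjSubgroup_of_mem {g : G} {H : Subgroup G} (h : g ∈ H) : conjSubgroup g H = H :=
  conjSubgroup_eq_of_conj_mem (fun _ hx => H.mul_mem (H.mul_mem h hx) (H.inv_mem h))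
    fun _ hx => H.mul_mem (H.mul_mem (H.inv_mem h) hx) h

/-- The stabiliser of a subgroup under conjugation. -/
def conjStabilizer (H : Subgroup G) : Subgroup G where
  carrier := {g | conjSubgroup g H = H}
  mul_mem' := by
    intro a b ha hb
    simp only [Set.mem_ofPred_eq] at *
    rw [conjSubgroup_mul, hb, ha]
  one_mem' := conjSubgroup_one H
  inv_mem' := by
    intro a ha
    simp only [Set.mem_ofPred_eq] at *
    nth_rw 1 [← ha]
    exact conjSubgroup_inv_conjSubgroup a H

theorem mem_conjStabilizer {g : G} {H : Subgroup G} :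
    g ∈ conjStabilizer H ↔ conjSubgroup g H = H := Iff.rfl

theorem normal_of_conjStabilizer_eq_top {H : Subgroup G} (h : conjStabilizer H = ⊤) : H.Normal :=
  normal_of_conjSubgroup_le fun g => by
    have : g ∈ conjStabilizer H := h ▸ Subgroup.mem_top g
    exact this.le

end ConjugateSubgroups

/-! ### Quasi-centralisers and locally normal subgroups. -/

section Topological

variable {G : Type*} [Group G] [TopologicalSpace G] [IsTopologicalGroup G]

theorem tendsto_conj_one (g : G) : Tendsto (fun x => g * x * g⁻¹) (𝓝 1) (𝓝 1) := by
  have : Continuous fun x : G => g * x * g⁻¹ := by fun_prop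
  simpa using this.tendsto 1

theorem tendsto_inv_conj_one (g : G) : Tendsto (fun x => g⁻¹ * x * g) (𝓝 1) (𝓝 1) := by
  simpa using tendsto_conj_one g⁻¹

theorem tendsto_commutator_one (g : G) : Tendsto (fun x => g * x * g⁻¹ * x⁻¹) (𝓝 1) (𝓝 1) := by
  have : Continuous fun x : G => g * x * g⁻¹ * x⁻¹ := by fun_prop
  simpa using this.tendsto 1

theorem eventually_conj_mem_of_isCompact {S : Set G} (hS : IsCompact S) {O : Set G}
    (hO : O ∈ 𝓝 (1 : G)) : ∀ᶠ v in 𝓝 (1 : G), ∀ s ∈ S, s * v * s⁻¹ ∈ O := by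
  refine hS.eventually_forall_of_forall_eventually fun s _ => ?_
  have : Continuous fun z : G × G => z.2 * z.1 * z.2⁻¹ := by fun_prop
  exact this.tendsto' (1, s) 1 (by simp) hO

/-- The elements of `W` all of whose conjugates by elements of `U` lie in `W`. -/
def coreIn (U W : Subgroup G) : Subgroup G where
  carrier := {v | ∀ u ∈ U, u * v * u⁻¹ ∈ W}
  mul_mem' := by
    intro a b ha hb u hu
    have := W.mul_mem (ha u hu) (hb u hu)
    simpa [mul_assoc] using this
  one_mem' := by simp
  inv_mem' := by
    intro a ha u hu
    have := W.inv_mem (ha u hu)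
    simpa [mul_assoc] using this

theorem isClosed_conjSubgroup (g : G) {H : Subgroup G} (hH : IsClosed (H : Set G)) :
    IsClosed (conjSubgroup g H : Set G) := by
  have : Continuous fun x : G => g⁻¹ * x * g := by fun_prop
  convert hH.preimage this using 1
  ext x
  exact mem_conjSubgroup

theorem isClosed_conjStabilizer {H : Subgroup G} (hH : IsClosed (H : Set G)) :
    IsClosed (conjStabilizer H : Set G) := by
  have : (conjStabilizer H : Set G) =
      ⋂ x ∈ H, {g : G | g * x * g⁻¹ ∈ (H : Set G)} ∩ {g : G | g⁻¹ * x * g ∈ (H : Set G)} := by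
    ext g
    simp only [SetLike.mem_coe, mem_conjStabilizer, Set.mem_iInter, Set.mem_inter_iff,
      Set.mem_ofPred_eq]
    refine ⟨fun h x hx => ⟨?_, ?_⟩, fun h => conjSubgroup_eq_of_conj_mem (fun x hx => (h x hx).1)
      fun x hx => (h x hx).2⟩
    · rw [← h]
      exact conj_mem_conjSubgroup.2 hx
    · rw [← h] at hx
      exact mem_conjSubgroup.1 hx
  rw [this]
  refine isClosed_biInter fun x _ => IsClosed.inter ?_ ?_
  · exact hH.preimage (by fun_prop)
  · exact hH.preimage (by fun_prop)

/-- Elements of `R` translate a point of the closure of `R` into the open subgroup `U`, where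
closedness is assumed. -/
theorem isClosed_of_isClosed_inter {R U : Subgroup G} (hU : IsOpen (U : Set G))
    (h : IsClosed ((R : Set G) ∩ U)) : IsClosed (R : Set G) := by
  rw [← closure_subset_iff_isClosed]
  intro x hx
  have hx' : x ∈ R.topologicalClosure := hx
  have hxU : (fun y => x⁻¹ * y) ⁻¹' (U : Set G) ∈ 𝓝 x := by
    have : Continuous fun y : G => x⁻¹ * y := by fun_prop
    exact (hU.preimage this).mem_nhds (by simp [U.one_mem])
  obtain ⟨r, hrU, hr⟩ := mem_closure_iff_nhds.1 hx _ hxU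
  have h1 : x⁻¹ * r ∈ closure ((R : Set G) ∩ U) := by
    rw [Set.inter_comm]
    refine hU.inter_closure ⟨hrU, ?_⟩
    exact R.topologicalClosure.mul_mem (R.topologicalClosure.inv_mem hx')
      (R.le_topologicalClosure hr)
  rw [h.closure_eq] at h1
  have := R.mul_mem hr (R.inv_mem h1.1)
  simpa using this

section TotallyDisconnected

variable [LocallyCompactSpace G] [TotallyDisconnectedSpace G]

theorem exists_compact_open_subgroup_subset {O : Set G} (hO : O ∈ 𝓝 (1 : G)) :
    ∃ U : Subgroup G, IsCompact (U : Set G) ∧ IsOpen (U : Set G) ∧ (U : Set G) ⊆ O := by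
  obtain ⟨U, hUc, hUo⟩ := exists_compact_open_subgroup G
  have : CompactSpace U := isCompact_iff_compactSpace.1 hUc
  have h1 : (Subtype.val : U → G) ⁻¹' interior O ∈ 𝓝 (1 : U) :=
    (isOpen_interior.preimage continuous_subtype_val).mem_nhds
      (by simpa using mem_interior_iff_mem_nhds.2 hO)
  obtain ⟨V, hV⟩ := ProfiniteGrp.exist_openNormalSubgroup_sub_open_nhds_of_one
    (isOpen_interior.preimage continuous_subtype_val) (mem_of_mem_nhds h1)
  have hVo : IsOpen ((V : Subgroup U) : Set U) := V.toOpenSubgroup.isOpen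
  refine ⟨(V : Subgroup U).map U.subtype, ?_, ?_, ?_⟩
  · exact ((Subgroup.isClosed_of_isOpen _ hVo).isCompact).image continuous_subtype_val
  · exact hUo.isOpenMap_subtype_val _ hVo
  · rintro _ ⟨x, hx, rfl⟩
    exact interior_subset (hV hx)

theorem exists_open_subgroup_conj_mem {U : Subgroup G} (hU : IsCompact (U : Set G)) {O : Set G}
    (hO : O ∈ 𝓝 (1 : G)) :
    ∃ W : Subgroup G, IsOpen (W : Set G) ∧ (W : Set G) ⊆ O ∧
      ∀ u ∈ U, ∀ w ∈ W, u * w * u⁻¹ ∈ W := by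
  obtain ⟨V, -, hVo, hVO⟩ := exists_compact_open_subgroup_subset hO
  refine ⟨coreIn U V, ?_, ?_, ?_⟩
  · exact Subgroup.isOpen_of_mem_nhds _ (g := 1)
      (eventually_conj_mem_of_isCompact hU (hVo.mem_nhds V.one_mem))
  · intro v hv
    have := hv 1 U.one_mem
    simp only [one_mul, inv_one, mul_one] at this
    exact hVO this
  · intro u hu w hw u' hu'
    have := hw (u' * u) (U.mul_mem hu' hu)
    simpa [mul_assoc] using this

end TotallyDisconnected

/-- The quasi-centraliser of `H`: the elements that centralise a neighbourhood of the identity in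
`H`. -/
def quasiCentralizer (H : Subgroup G) : Subgroup G where
  carrier := {g | ∀ᶠ x in 𝓝 (1 : G), x ∈ H → g * x = x * g}
  mul_mem' := by
    intro a b ha hb
    filter_upwards [ha, hb] with x hax hbx hx
    rw [mul_assoc, hbx hx, ← mul_assoc, hax hx, mul_assoc]
  one_mem' := by simp
  inv_mem' := by
    intro a ha
    filter_upwards [ha] with x hax hx
    exact (Commute.inv_left (hax hx)).eq

theorem quasiCentralizer_anti_of_eventually {H K : Subgroup G}
    (h : ∀ᶠ x in 𝓝 (1 : G), x ∈ H → x ∈ K) : quasiCentralizer K ≤ quasiCentralizer H := by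
  intro g hg
  filter_upwards [hg, h] with x h1 h2 hx
  exact h1 (h2 hx)

theorem quasiCentralizer_anti {H K : Subgroup G} (h : H ≤ K) :
    quasiCentralizer K ≤ quasiCentralizer H :=
  quasiCentralizer_anti_of_eventually (Eventually.of_forall fun _ hx => h hx)

theorem conj_mem_quasiCentralizer {H : Subgroup G} {g c : G} (hc : c ∈ quasiCentralizer H)
    (h : ∀ᶠ x in 𝓝 (1 : G), x ∈ H → g⁻¹ * x * g ∈ H) :
    g * c * g⁻¹ ∈ quasiCentralizer H := by
  filter_upwards [h, (tendsto_inv_conj_one g).eventually hc] with x h1 h2 hx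
  have := h2 (h1 hx)
  calc g * c * g⁻¹ * x = g * (c * (g⁻¹ * x * g)) * g⁻¹ := by group
    _ = g * ((g⁻¹ * x * g) * c) * g⁻¹ := by rw [this]
    _ = x * (g * c * g⁻¹) := by group

theorem quasiCentralizer_conjSubgroup (g : G) (H : Subgroup G) :
    quasiCentralizer (conjSubgroup g H) = conjSubgroup g (quasiCentralizer H) := by
  have key : ∀ (g : G) (H : Subgroup G),
      conjSubgroup g (quasiCentralizer H) ≤ quasiCentralizer (conjSubgroup g H) := by
    intro g H x hx
    rw [mem_conjSubgroup] at hx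
    filter_upwards [(tendsto_inv_conj_one g).eventually hx] with y hy hyH
    have := hy (mem_conjSubgroup.1 hyH)
    calc x * y = g * (g⁻¹ * x * g * (g⁻¹ * y * g)) * g⁻¹ := by group
      _ = g * (g⁻¹ * y * g * (g⁻¹ * x * g)) * g⁻¹ := by rw [this]
      _ = y * x := by group
  refine le_antisymm ?_ (key g H)
  have := conjSubgroup_mono g (key g⁻¹ (conjSubgroup g H))
  simpa using this

/-- A closed subgroup that is normalised by a neighbourhood of the identity. -/
structure IsLocallyNormal (H : Subgroup G) : Prop where
  isClosed : IsClosed (H : Set G)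
  eventually_conj_mem : ∀ᶠ u in 𝓝 (1 : G), ∀ x ∈ H, u * x * u⁻¹ ∈ H

theorem IsLocallyNormal.conj {H : Subgroup G} (hH : IsLocallyNormal H) (g : G) :
    IsLocallyNormal (conjSubgroup g H) where
  isClosed := isClosed_conjSubgroup g hH.isClosed
  eventually_conj_mem := by
    filter_upwards [(tendsto_inv_conj_one g).eventually hH.eventually_conj_mem] with u hu x hx
    rw [mem_conjSubgroup] at *
    have := hu _ hx
    simpa [mul_assoc] using this

theorem IsLocallyNormal.inf {H K : Subgroup G} (hH : IsLocallyNormal H)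
    (hK : IsLocallyNormal K) : IsLocallyNormal (H ⊓ K) where
  isClosed := hH.isClosed.inter hK.isClosed
  eventually_conj_mem := by
    filter_upwards [hH.eventually_conj_mem, hK.eventually_conj_mem] with u h1 h2 x hx
    exact ⟨h1 x hx.1, h2 x hx.2⟩

theorem IsLocallyNormal.top : IsLocallyNormal (⊤ : Subgroup G) where
  isClosed := isClosed_univ
  eventually_conj_mem := by simp

theorem IsLocallyNormal.of_isOpen {U : Subgroup G} (hU : IsOpen (U : Set G)) :
    IsLocallyNormal U where
  isClosed := U.isClosed_of_isOpen hU
  eventually_conj_mem := by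
    filter_upwards [hU.mem_nhds U.one_mem] with u hu x hx
    exact U.mul_mem (U.mul_mem hu hx) (U.inv_mem hu)

theorem IsLocallyNormal.of_conj_mem {H U : Subgroup G} (hH : IsClosed (H : Set G))
    (hU : IsOpen (U : Set G)) (h : ∀ u ∈ U, ∀ x ∈ H, u * x * u⁻¹ ∈ H) : IsLocallyNormal H :=
  ⟨hH, by filter_upwards [hU.mem_nhds U.one_mem] with u hu using h u hu⟩

theorem IsLocallyNormal.eventually_conjSubgroup_eq {H : Subgroup G} (hH : IsLocallyNormal H) :
    ∀ᶠ u in 𝓝 (1 : G), conjSubgroup u H = H := by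
  have h : Tendsto (fun u : G => u⁻¹) (𝓝 1) (𝓝 1) := by
    simpa using (continuous_inv (G := G)).tendsto 1
  filter_upwards [hH.eventually_conj_mem, h.eventually hH.eventually_conj_mem] with u h1 h2
  exact conjSubgroup_eq_of_conj_mem h1 (by simpa using h2)

theorem IsLocallyNormal.exists_subgroup [LocallyCompactSpace G] [TotallyDisconnectedSpace G]
    {H : Subgroup G} (hH : IsLocallyNormal H) :
    ∃ U : Subgroup G, IsCompact (U : Set G) ∧ IsOpen (U : Set G) ∧
      ∀ u ∈ U, ∀ x ∈ H, u * x * u⁻¹ ∈ H := by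
  obtain ⟨U, h1, h2, h3⟩ := exists_compact_open_subgroup_subset hH.eventually_conj_mem
  exact ⟨U, h1, h2, fun u hu => h3 hu⟩

/-- The commutator of a fixed x in `H` with u near 1 lies in `H` and near 1, hence is trivial; so x
lies in the quasi-centre. -/
theorem IsLocallyNormal.eq_bot_of_eventually (hq : quasiCentralizer (⊤ : Subgroup G) = ⊥)
    {H : Subgroup G} (hH : IsLocallyNormal H) (h : ∀ᶠ x in 𝓝 (1 : G), x ∈ H → x = 1) :
    H = ⊥ := by
  rw [eq_bot_iff, ← hq]
  intro x hx
  filter_upwards [hH.eventually_conj_mem, (tendsto_commutator_one x).eventually h] with u h1 h2 _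
  have h3 : x * u * x⁻¹ * u⁻¹ ∈ H := by
    have := H.mul_mem hx (h1 _ (H.inv_mem hx))
    simpa [mul_assoc] using this
  have h4 := h2 h3
  rw [mul_inv_eq_one, mul_inv_eq_iff_eq_mul] at h4
  exact h4

/-- The group has no non-trivial abelian locally normal subgroup. -/
def NoAbelianLocallyNormal (G : Type*) [Group G] [TopologicalSpace G] [IsTopologicalGroup G] :
    Prop :=
  ∀ H : Subgroup G, IsLocallyNormal H → (∀ x ∈ H, ∀ y ∈ H, x * y = y * x) → H = ⊥

theorem IsLocallyNormal.eq_bot_of_inf_eq_bot (hq : quasiCentralizer (⊤ : Subgroup G) = ⊥)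
    {H U : Subgroup G} (hH : IsLocallyNormal H) (hU : IsOpen (U : Set G)) (h : H ⊓ U = ⊥) :
    H = ⊥ := by
  refine hH.eq_bot_of_eventually hq ?_
  filter_upwards [hU.mem_nhds U.one_mem] with x hx hxH
  have : x ∈ H ⊓ U := ⟨hxH, hx⟩
  rwa [h] at this

end Topological

/-! ### Bicommutants when the quasi-centre and abelian locally normal subgroups are trivial. -/

section Semisimple

variable {G : Type*} [Group G] [TopologicalSpace G] [IsTopologicalGroup G]
  [LocallyCompactSpace G] [TotallyDisconnectedSpace G]

/-- Commutation near 1 spreads to `U`. With c centralising `H ⊓ W`, the centraliser of `H ⊓ W` meets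
`H ⊓ U` in a locally normal subgroup that is abelian near 1, hence trivial; the commutator of c and
h lies there. -/
theorem commute_of_mem_quasiCentralizer (hq : quasiCentralizer (⊤ : Subgroup G) = ⊥)
    (ha : NoAbelianLocallyNormal G) {H U : Subgroup G} (hH : IsClosed (H : Set G))
    (hUc : IsCompact (U : Set G)) (hUo : IsOpen (U : Set G))
    (hU : ∀ u ∈ U, ∀ x ∈ H, u * x * u⁻¹ ∈ H) {c h : G} (hc : c ∈ quasiCentralizer H)
    (hcU : c ∈ U) (hh : h ∈ H) (hhU : h ∈ U) : c * h = h * c := by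
  obtain ⟨W, hWo, hW, hUW⟩ := exists_open_subgroup_conj_mem hUc hc
  let C := Subgroup.centralizer ((H ⊓ W : Subgroup G) : Set G)
  have hconj : ∀ u ∈ U, ∀ x ∈ C, u * x * u⁻¹ ∈ C := by
    intro u hu x hx
    rw [Subgroup.mem_centralizer_iff] at hx ⊢
    intro w hw
    have h1 := hU _ (U.inv_mem hu) _ hw.1
    have h2 := hUW _ (U.inv_mem hu) _ hw.2
    have := hx _ ⟨h1, h2⟩
    calc w * (u * x * u⁻¹) = u * (u⁻¹ * w * u⁻¹⁻¹ * x) * u⁻¹ := by group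
      _ = u * (x * (u⁻¹ * w * u⁻¹⁻¹)) * u⁻¹ := by rw [this]
      _ = u * x * u⁻¹ * w := by group
  have hUcl := U.isClosed_of_isOpen hUo
  have hY : IsLocallyNormal (H ⊓ U ⊓ C) := by
    refine IsLocallyNormal.of_conj_mem
      ((hH.inter hUcl).inter (Set.isClosed_centralizer _)) hUo ?_
    rintro u hu x ⟨⟨h1, h2⟩, h3⟩
    exact ⟨⟨hU u hu x h1, U.mul_mem (U.mul_mem hu h2) (U.inv_mem hu)⟩, hconj u hu x h3⟩
  have hY' : H ⊓ U ⊓ C ⊓ W = ⊥ := by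
    refine ha _ (hY.inf (.of_isOpen hWo)) ?_
    rintro x ⟨⟨⟨hx1, hx2⟩, hx3⟩, hx4⟩ y ⟨⟨⟨hy1, hy2⟩, hy3⟩, hy4⟩
    exact Subgroup.mem_centralizer_iff.1 hy3 x ⟨hx1, hx4⟩
  have hY0 := hY.eq_bot_of_inf_eq_bot hq hWo hY'
  have hcC : c ∈ C := by
    refine Subgroup.mem_centralizer_iff.2 fun x hx => ?_
    exact (hW hx.2 hx.1).symm
  have hmem : c * h * c⁻¹ * h⁻¹ ∈ H ⊓ U ⊓ C := by
    refine ⟨⟨H.mul_mem (hU _ hcU _ hh) (H.inv_mem hh), ?_⟩, ?_⟩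
    · exact U.mul_mem (U.mul_mem (U.mul_mem hcU hhU) (U.inv_mem hcU)) (U.inv_mem hhU)
    · have := C.mul_mem hcC (hconj h hhU _ (C.inv_mem hcC))
      simpa [mul_assoc] using this
  rw [hY0, Subgroup.mem_bot, mul_inv_eq_one, mul_inv_eq_iff_eq_mul] at hmem
  exact hmem

/-- This turns the germ-level notion into an actual centraliser: it makes quasi-centralisers closed
and ties them to the classes of `C_U(K)`. -/
theorem quasiCentralizer_inf_eq (hq : quasiCentralizer (⊤ : Subgroup G) = ⊥)
    (ha : NoAbelianLocallyNormal G) {H U : Subgroup G} (hH : IsClosed (H : Set G))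
    (hUc : IsCompact (U : Set G)) (hUo : IsOpen (U : Set G))
    (hU : ∀ u ∈ U, ∀ x ∈ H, u * x * u⁻¹ ∈ H) :
    quasiCentralizer H ⊓ U = U ⊓ Subgroup.centralizer ((H ⊓ U : Subgroup G) : Set G) := by
  ext c
  constructor
  · rintro ⟨hc, hcU⟩
    refine ⟨hcU, Subgroup.mem_centralizer_iff.2 fun h hh => ?_⟩
    exact (commute_of_mem_quasiCentralizer hq ha hH hUc hUo hU hc hcU hh.1 hh.2).symm
  · rintro ⟨hcU, hc⟩
    refine ⟨?_, hcU⟩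
    filter_upwards [hUo.mem_nhds U.one_mem] with x hx hxH
    exact (Subgroup.mem_centralizer_iff.1 hc x ⟨hxH, hx⟩).symm

theorem IsLocallyNormal.isLocallyNormal_quasiCentralizer
    (hq : quasiCentralizer (⊤ : Subgroup G) = ⊥)
    (ha : NoAbelianLocallyNormal G) {H : Subgroup G} (hH : IsLocallyNormal H) :
    IsLocallyNormal (quasiCentralizer H) := by
  obtain ⟨U, hUc, hUo, hU⟩ := hH.exists_subgroup
  refine .of_conj_mem (isClosed_of_isClosed_inter hUo ?_) hUo ?_
  · rw [← Subgroup.coe_inf, quasiCentralizer_inf_eq hq ha hH.isClosed hUc hUo hU]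
    exact (U.isClosed_of_isOpen hUo).inter (Set.isClosed_centralizer _)
  · intro u hu c hc
    refine conj_mem_quasiCentralizer hc (Eventually.of_forall fun x hx => ?_)
    simpa using hU _ (U.inv_mem hu) _ hx

theorem IsLocallyNormal.inf_quasiCentralizer (hq : quasiCentralizer (⊤ : Subgroup G) = ⊥)
    (ha : NoAbelianLocallyNormal G) {H : Subgroup G} (hH : IsLocallyNormal H) :
    H ⊓ quasiCentralizer H = ⊥ := by
  obtain ⟨U, hUc, hUo, hU⟩ := hH.exists_subgroup
  have hY := hH.inf (hH.isLocallyNormal_quasiCentralizer hq ha)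
  refine hY.eq_bot_of_inf_eq_bot hq hUo (ha _ (hY.inf (.of_isOpen hUo)) ?_)
  rintro x ⟨⟨hx1, hx2⟩, hx3⟩ y ⟨⟨hy1, hy2⟩, hy3⟩
  exact commute_of_mem_quasiCentralizer hq ha hH.isClosed hUc hUo hU hx2 hx3 hy1 hy3

theorem IsLocallyNormal.le_quasiCentralizer_quasiCentralizer
    (hq : quasiCentralizer (⊤ : Subgroup G) = ⊥)
    (ha : NoAbelianLocallyNormal G) {H : Subgroup G} (hH : IsLocallyNormal H) :
    H ≤ quasiCentralizer (quasiCentralizer H) := by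
  intro x hx
  filter_upwards [hH.eventually_conj_mem] with e he heC
  have h1 : x * e * x⁻¹ * e⁻¹ ∈ H ⊓ quasiCentralizer H := by
    refine ⟨?_, ?_⟩
    · have := H.mul_mem hx (he _ (H.inv_mem hx))
      simpa [mul_assoc] using this
    · refine Subgroup.mul_mem _ (conj_mem_quasiCentralizer heC ?_) (Subgroup.inv_mem _ heC)
      exact Eventually.of_forall fun y hy => H.mul_mem (H.mul_mem (H.inv_mem hx) hy) hx
  rw [hH.inf_quasiCentralizer hq ha, Subgroup.mem_bot, mul_inv_eq_one,
    mul_inv_eq_iff_eq_mul] at h1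
  exact h1

/-- The locally normal subgroups that coincide with their double quasi-centraliser. They are the
global representatives of the elements of the centraliser lattice. -/
structure IsBicommutant (R : Subgroup G) : Prop extends IsLocallyNormal R where
  quasiCentralizer_quasiCentralizer_le : quasiCentralizer (quasiCentralizer R) ≤ R

theorem IsLocallyNormal.isBicommutant_quasiCentralizer
    (hq : quasiCentralizer (⊤ : Subgroup G) = ⊥)
    (ha : NoAbelianLocallyNormal G) {H : Subgroup G} (hH : IsLocallyNormal H) :
    IsBicommutant (quasiCentralizer H) :=
  ⟨hH.isLocallyNormal_quasiCentralizer hq ha,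
    quasiCentralizer_anti (hH.le_quasiCentralizer_quasiCentralizer hq ha)⟩

theorem IsBicommutant.conj {R : Subgroup G} (hR : IsBicommutant R) (g : G) :
    IsBicommutant (conjSubgroup g R) := by
  refine ⟨hR.toIsLocallyNormal.conj g, ?_⟩
  rw [quasiCentralizer_conjSubgroup, quasiCentralizer_conjSubgroup]
  exact conjSubgroup_mono g hR.quasiCentralizer_quasiCentralizer_le

theorem IsBicommutant.inf {R S : Subgroup G} (hR : IsBicommutant R) (hS : IsBicommutant S) :
    IsBicommutant (R ⊓ S) :=
  ⟨hR.toIsLocallyNormal.inf hS.toIsLocallyNormal, le_inf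
    ((quasiCentralizer_anti (quasiCentralizer_anti inf_le_left)).trans
      hR.quasiCentralizer_quasiCentralizer_le)
    ((quasiCentralizer_anti (quasiCentralizer_anti inf_le_right)).trans
      hS.quasiCentralizer_quasiCentralizer_le)⟩

theorem IsBicommutant.top : IsBicommutant (⊤ : Subgroup G) :=
  ⟨.top, le_top⟩

/-- A bicommutant and its quasi-centraliser normalise each other and meet trivially, so they commute
globally and not only near 1. -/
theorem IsBicommutant.commute (hq : quasiCentralizer (⊤ : Subgroup G) = ⊥)
    (ha : NoAbelianLocallyNormal G) {R : Subgroup G} (hR : IsBicommutant R) {x c : G} (hx : x ∈ R)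
    (hc : c ∈ quasiCentralizer R) : x * c = c * x := by
  have h1 : x * c * x⁻¹ * c⁻¹ ∈ R ⊓ quasiCentralizer R := by
    refine ⟨?_, ?_⟩
    · have h2 : c * x⁻¹ * c⁻¹ ∈ quasiCentralizer (quasiCentralizer R) := by
        refine conj_mem_quasiCentralizer
          (hR.le_quasiCentralizer_quasiCentralizer hq ha (R.inv_mem hx)) ?_
        exact Eventually.of_forall fun y hy =>
          Subgroup.mul_mem _ (Subgroup.mul_mem _ (Subgroup.inv_mem _ hc) hy) hc
      have := R.mul_mem hx (hR.quasiCentralizer_quasiCentralizer_le h2)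
      simpa [mul_assoc] using this
    · refine Subgroup.mul_mem _ (conj_mem_quasiCentralizer hc ?_) (Subgroup.inv_mem _ hc)
      exact Eventually.of_forall fun y hy => R.mul_mem (R.mul_mem (R.inv_mem hx) hy) hx
  rw [hR.inf_quasiCentralizer hq ha, Subgroup.mem_bot, mul_inv_eq_one,
    mul_inv_eq_iff_eq_mul] at h1
  exact h1

/-- Near 1 the two subgroups normalise each other, so small elements commute; taking double
quasi-centralisers removes the smallness. -/
theorem IsBicommutant.le_quasiCentralizer_of_inf_eq_bot
    (hq : quasiCentralizer (⊤ : Subgroup G) = ⊥)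
    (ha : NoAbelianLocallyNormal G) {R S : Subgroup G} (hR : IsBicommutant R) (hS : IsBicommutant S)
    (h : R ⊓ S = ⊥) : R ≤ quasiCentralizer S := by
  have h1 : ∀ᶠ x in 𝓝 (1 : G), x ∈ R → x ∈ quasiCentralizer S := by
    filter_upwards [hS.eventually_conj_mem] with x hx hxR
    filter_upwards [hR.eventually_conj_mem] with y hy hyS
    have h2 : x * y * x⁻¹ * y⁻¹ ∈ R ⊓ S := by
      refine ⟨?_, S.mul_mem (hx _ hyS) (S.inv_mem hyS)⟩
      have := R.mul_mem hxR (hy _ (R.inv_mem hxR))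
      simpa [mul_assoc] using this
    rw [h, Subgroup.mem_bot, mul_inv_eq_one, mul_inv_eq_iff_eq_mul] at h2
    exact h2
  exact (hR.le_quasiCentralizer_quasiCentralizer hq ha).trans
    ((quasiCentralizer_anti (quasiCentralizer_anti_of_eventually h1)).trans
      (hS.isBicommutant_quasiCentralizer hq ha).quasiCentralizer_quasiCentralizer_le)

theorem IsBicommutant.le_of_inf_quasiCentralizer_eq_bot
    (hq : quasiCentralizer (⊤ : Subgroup G) = ⊥)
    (ha : NoAbelianLocallyNormal G) {R S : Subgroup G} (hR : IsBicommutant R) (hS : IsBicommutant S)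
    (h : R ⊓ quasiCentralizer S = ⊥) : R ≤ S :=
  (hR.le_quasiCentralizer_of_inf_eq_bot hq ha (hS.isBicommutant_quasiCentralizer hq ha) h).trans
    hS.quasiCentralizer_quasiCentralizer_le

end Semisimple

/-! ### Finiteness of orbits of locally normal subgroups under compact sets. -/

section FiniteSaturation

variable {G : Type*} [Group G] [TopologicalSpace G] [IsTopologicalGroup G]

theorem IsLocallyNormal.finite_image_conjSubgroup {H : Subgroup G} (hH : IsLocallyNormal H)
    {Q : Set G} (hQ : IsCompact Q) : ((fun g => conjSubgroup g H) '' Q).Finite := by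
  have hnhds : ∀ x ∈ Q, {y | conjSubgroup y H = conjSubgroup x H} ∈ 𝓝 x := by
    intro x _
    have : Tendsto (fun y : G => x⁻¹ * y) (𝓝 x) (𝓝 1) := by
      have h : Continuous fun y : G => x⁻¹ * y := by fun_prop
      simpa using h.tendsto x
    filter_upwards [this.eventually hH.eventually_conjSubgroup_eq] with y hy
    have h2 : y = x * (x⁻¹ * y) := by group
    rw [h2, conjSubgroup_mul, hy]
  obtain ⟨t, -, ht⟩ := hQ.elim_nhds_subcover _ hnhds
  refine (t.finite_toSet.image fun g => conjSubgroup g H).subset ?_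
  rintro _ ⟨y, hy, rfl⟩
  obtain ⟨x, hx, hxy⟩ := Set.mem_iUnion₂.1 (ht hy)
  exact ⟨x, hx, hxy.symm⟩

theorem exists_finite_invariant_superset {T : Set (Subgroup G)} (hT : T.Finite)
    (hn : ∀ H ∈ T, IsLocallyNormal H) {U : Subgroup G} (hU : IsCompact (U : Set G)) :
    ∃ T' : Set (Subgroup G), T'.Finite ∧ T ⊆ T' ∧
      (∀ H ∈ T', ∃ u ∈ U, ∃ K ∈ T, H = conjSubgroup u K) ∧
      ∀ u ∈ U, ∀ H ∈ T', conjSubgroup u H ∈ T' := by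
  refine ⟨⋃ H ∈ T, (fun g => conjSubgroup g H) '' U, ?_, ?_, ?_, ?_⟩
  · exact hT.biUnion fun H hH => (hn H hH).finite_image_conjSubgroup hU
  · intro H hH
    exact Set.mem_biUnion hH ⟨1, U.one_mem, conjSubgroup_one H⟩
  · intro H hH
    obtain ⟨K, hK, u, hu, rfl⟩ := Set.mem_iUnion₂.1 hH
    exact ⟨u, hu, K, hK, rfl⟩
  · intro u hu H hH
    obtain ⟨K, hK, v, hv, rfl⟩ := Set.mem_iUnion₂.1 hH
    exact Set.mem_biUnion hK ⟨u * v, U.mul_mem hu hv, conjSubgroup_mul _ _ _⟩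

theorem closure_le_conjStabilizer {H : Subgroup G} {S : Set G}
    (h : ∀ s ∈ S, conjSubgroup s H = H) : Subgroup.closure S ≤ conjStabilizer H :=
  (Subgroup.closure_le _).2 h

end FiniteSaturation

/-! ### Groups in 𝒮: trivial quasi-centre and no abelian locally normal subgroups. -/

section ClassS

variable {G : Type*} [Group G] [TopologicalSpace G] [IsTopologicalGroup G] [IsClassS G]

theorem eq_bot_or_top_of_normal {N : Subgroup G} (h : N.Normal) (hc : IsClosed (N : Set G)) :
    N = ⊥ ∨ N = ⊤ :=
  (IsClassS.topologicallySimple (G := G)).2 N h hc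

theorem topologicalClosure_eq_top {N : Subgroup G} (h : N.Normal) (hN : N ≠ ⊥) :
    N.topologicalClosure = ⊤ := by
  refine (eq_bot_or_top_of_normal (Subgroup.is_normal_topologicalClosure N)
    N.isClosed_topologicalClosure).resolve_left fun h0 => hN ?_
  rw [eq_bot_iff, ← h0]
  exact N.le_topologicalClosure

theorem ne_bot_of_isOpen {U : Subgroup G} (hU : IsOpen (U : Set G)) : U ≠ ⊥ := by
  rintro rfl
  refine IsClassS.nondiscrete (G := G) (discreteTopology_of_isOpen_singleton_one ?_)
  simpa using hU

theorem eq_top_of_isOpen_of_conj_mem {S : Set G} (hS : Subgroup.closure S = ⊤) {W : Subgroup G}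
    (hW : IsOpen (W : Set G)) (h : ∀ s ∈ S, conjSubgroup s W = W) : W = ⊤ :=
  (eq_bot_or_top_of_normal
    (normal_of_conjStabilizer_eq_top (top_le_iff.1 (hS ▸ closure_le_conjStabilizer h)))
    (W.isClosed_of_isOpen hW)).resolve_left (ne_bot_of_isOpen hW)

theorem exists_mem_nhds_one_ne_univ (G : Type*) [Group G] [TopologicalSpace G]
    [IsTopologicalGroup G] [IsClassS G] :
    ∃ O ∈ 𝓝 (1 : G), ∀ W : Subgroup G, (W : Set G) ⊆ O → W ≠ ⊤ := by
  obtain ⟨x, hx⟩ := @exists_ne G (IsClassS.topologicallySimple (G := G)).1 1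
  refine ⟨{x}ᶜ, isOpen_compl_singleton.mem_nhds hx.symm, fun W hW h => ?_⟩
  have : x ∈ W := h ▸ Subgroup.mem_top x
  exact hW this rfl

/-- Finitely many cosets of `U` with representatives in the dense subgroup `D` cover the compact
generating set. -/
theorem exists_finite_generating {D U : Subgroup G} (hD : D.topologicalClosure = ⊤)
    (hU : IsOpen (U : Set G)) :
    ∃ F : Set G, F.Finite ∧ F ⊆ D ∧ Subgroup.closure (F ∪ U) = ⊤ := by
  obtain ⟨S, hS, hgen⟩ := IsClassS.compactlyGenerated (G := G)
  have hd : ∀ s : G, ∃ d ∈ D, d⁻¹ * s ∈ U := by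
    intro s
    have hs : s ∈ closure (D : Set G) := by
      have : s ∈ D.topologicalClosure := hD ▸ Subgroup.mem_top s
      exact this
    have hc : Continuous fun y : G => y⁻¹ * s := by fun_prop
    obtain ⟨d, hdU, hdD⟩ := mem_closure_iff.1 hs _ (hU.preimage hc) (by simp [U.one_mem])
    exact ⟨d, hdD, hdU⟩
  choose d hdD hdU using hd
  have hn : ∀ s ∈ S, {y | (d s)⁻¹ * y ∈ U} ∈ 𝓝 s := by
    intro s _
    have hc : Continuous fun y : G => (d s)⁻¹ * y := by fun_prop
    exact (hU.preimage hc).mem_nhds (hdU s)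
  obtain ⟨t, -, ht⟩ := hS.elim_nhds_subcover _ hn
  refine ⟨d '' t, t.finite_toSet.image d, ?_, ?_⟩
  · rintro _ ⟨s, -, rfl⟩
    exact hdD s
  · rw [eq_top_iff, ← hgen, Subgroup.closure_le]
    intro y hy
    obtain ⟨s, hs, hsy⟩ := Set.mem_iUnion₂.1 (ht hy)
    have h1 : d s ∈ Subgroup.closure (d '' t ∪ U) :=
      Subgroup.subset_closure (Or.inl ⟨s, hs, rfl⟩)
    have h2 : (d s)⁻¹ * y ∈ Subgroup.closure (d '' t ∪ U) :=
      Subgroup.subset_closure (Or.inr hsy)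
    simpa using Subgroup.mul_mem _ h1 h2

theorem conjSubgroup_eq_of_forall_conj_mem {U W : Subgroup G}
    (h : ∀ u ∈ U, ∀ w ∈ W, u * w * u⁻¹ ∈ W) {u : G} (hu : u ∈ U) : conjSubgroup u W = W :=
  conjSubgroup_eq_of_conj_mem (h u hu) fun w hw => by
    simpa using h _ (U.inv_mem hu) w hw

theorem quasiCentralizer_normal {H : Subgroup G} (hH : H.Normal) :
    (quasiCentralizer H).Normal :=
  normal_of_conjSubgroup_le fun g => by
    rw [← quasiCentralizer_conjSubgroup]
    refine quasiCentralizer_anti fun x hx => mem_conjSubgroup.2 ?_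
    simpa using hH.conj_mem x hx g⁻¹

/-- A non-trivial quasi-centre would be dense, so `U` and finitely many of its elements would
generate G. A small open subgroup normalised by `U` and centralised by those elements would be
normal, hence all of G. -/
theorem quasiCentralizer_top : quasiCentralizer (⊤ : Subgroup G) = ⊥ := by
  by_contra hne
  obtain ⟨U, hUc, hUo⟩ := exists_compact_open_subgroup G
  obtain ⟨F, hF, hFD, hgen⟩ := exists_finite_generating
    (topologicalClosure_eq_top (quasiCentralizer_normal inferInstance) hne) hUo
  obtain ⟨O, hO, hOtop⟩ := exists_mem_nhds_one_ne_univ G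
  have h1 : ∀ᶠ x in 𝓝 (1 : G), ∀ f ∈ F, f * x = x * f := by
    refine (eventually_all_finite hF).2 fun f hf => ?_
    filter_upwards [hFD hf] with x hx using hx trivial
  obtain ⟨W, hWo, hWO, hUW⟩ := exists_open_subgroup_conj_mem hUc (inter_mem hO h1)
  refine hOtop W (fun x hx => (hWO hx).1) (eq_top_of_isOpen_of_conj_mem hgen hWo ?_)
  rintro s (hs | hs)
  · have hc : ∀ x ∈ W, s * x = x * s := fun x hx => (hWO hx).2 s hs
    refine conjSubgroup_eq_of_conj_mem (fun x hx => ?_) fun x hx => ?_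
    · rwa [hc x hx, mul_inv_cancel_right]
    · rwa [mul_assoc, ← hc x hx, inv_mul_cancel_left]
  · exact conjSubgroup_eq_of_forall_conj_mem hUW hs

/-- A monotone, conjugation-equivariant family of subgroups indexed by sets of conjugates of a
non-trivial locally normal subgroup generates `G` together with a compact open subgroup, already
for a finite index set. -/
theorem exists_finite_sup_eq_top {δ : Subgroup G} (hδ : IsLocallyNormal δ) (hδ0 : δ ≠ ⊥)
    {S : Set (Subgroup G) → Subgroup G} (hS : Monotone S)
    (hconj : ∀ g T, conjSubgroup g (S T) = S (conjSubgroup g '' T)) (hδS : δ ≤ S {δ})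
    {U : Subgroup G} (hUc : IsCompact (U : Set G)) (hUo : IsOpen (U : Set G)) :
    ∃ T : Set (Subgroup G), T.Finite ∧ (∀ H ∈ T, ∃ g, H = conjSubgroup g δ) ∧ δ ∈ T ∧
      (∀ u ∈ U, ∀ H ∈ T, conjSubgroup u H ∈ T) ∧ S T ⊔ U = ⊤ := by
  let p : Set (Subgroup G) → Prop := fun T => T.Finite ∧ ∀ H ∈ T, ∃ g, H = conjSubgroup g δ
  have hp : ∀ T T', p T → p T' → p (T ∪ T') := fun T T' h h' =>
    ⟨h.1.union h'.1, fun H hH => hH.elim (h.2 H) (h'.2 H)⟩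
  have hp1 : p {δ} := ⟨Set.finite_singleton _, fun H hH => ⟨1, by simpa using hH⟩⟩
  -- A directed union over finite sets of conjugates: it is normal, and any finite subset of it lies
  -- in a single `S T`.
  let D : Subgroup G :=
    { carrier := {x | ∃ T, p T ∧ x ∈ S T}
      mul_mem' := by
        rintro a b ⟨T, hT, ha⟩ ⟨T', hT', hb⟩
        exact ⟨T ∪ T', hp T T' hT hT', (S _).mul_mem (hS Set.subset_union_left ha)
          (hS Set.subset_union_right hb)⟩
      one_mem' := ⟨_, hp1, (S _).one_mem⟩
      inv_mem' := by
        rintro a ⟨T, hT, ha⟩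
        exact ⟨T, hT, (S _).inv_mem ha⟩ }
  have hDn : D.Normal := by
    refine ⟨?_⟩
    rintro n ⟨T, hT, hn⟩ g
    refine ⟨conjSubgroup g '' T, ⟨hT.1.image _, ?_⟩, ?_⟩
    · rintro _ ⟨H, hH, rfl⟩
      obtain ⟨h, rfl⟩ := hT.2 H hH
      exact ⟨g * h, (conjSubgroup_mul _ _ _).symm⟩
    · rw [← hconj]
      exact conj_mem_conjSubgroup.2 hn
  have hD0 : D ≠ ⊥ := fun h => hδ0 (eq_bot_iff.2 (h ▸ fun x hx => ⟨_, hp1, hδS hx⟩))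
  obtain ⟨F, hF, hFD, hgen⟩ :=
    exists_finite_generating (topologicalClosure_eq_top hDn hD0) hUo
  have key : ∃ T, p T ∧ F ⊆ S T := by
    clear hgen
    induction F, hF using Set.Finite.induction_on with
    | empty => exact ⟨_, hp1, Set.empty_subset _⟩
    | insert _ _ ih =>
      obtain ⟨h1, h2⟩ := Set.insert_subset_iff.1 hFD
      obtain ⟨T, hT, hT'⟩ := ih h2
      obtain ⟨T₁, hT₁, hT₁'⟩ := h1
      refine ⟨T₁ ∪ T, hp _ _ hT₁ hT, Set.insert_subset (hS Set.subset_union_left hT₁') ?_⟩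
      exact hT'.trans (hS Set.subset_union_right)
  obtain ⟨T, hT, hFT⟩ := key
  have hT1 := hp _ _ hT hp1
  obtain ⟨T', hT'f, hTT', horb, hinv⟩ := exists_finite_invariant_superset hT1.1 (U := U)
    (fun H hH => by obtain ⟨g, rfl⟩ := hT1.2 H hH; exact hδ.conj g) hUc
  refine ⟨T', hT'f, ?_, hTT' (Or.inr rfl), hinv, ?_⟩
  · intro H hH
    obtain ⟨u, -, K, hK, rfl⟩ := horb H hH
    obtain ⟨g, rfl⟩ := hT1.2 K hK
    exact ⟨u * g, (conjSubgroup_mul _ _ _).symm⟩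
  · rw [eq_top_iff, ← hgen, Subgroup.closure_le]
    rintro x (hx | hx)
    · exact Subgroup.mem_sup_left (hS (Set.subset_union_left.trans hTT') (hFT hx))
    · exact Subgroup.mem_sup_right hx

theorem image_conjSubgroup_eq {T : Set (Subgroup G)} {U : Subgroup G}
    (h : ∀ u ∈ U, ∀ H ∈ T, conjSubgroup u H ∈ T) {u : G} (hu : u ∈ U) :
    conjSubgroup u '' T = T := by
  refine Set.Subset.antisymm ?_ fun H hH => ?_
  · rintro _ ⟨H, hH, rfl⟩
    exact h u hu H hH
  · exact ⟨_, h _ (U.inv_mem hu) H hH, conjSubgroup_conjSubgroup_inv u H⟩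

theorem conjSubgroup_iInf_quasiCentralizer (g : G) (T : Set (Subgroup G)) :
    conjSubgroup g (⨅ H ∈ T, quasiCentralizer H) =
      ⨅ H ∈ conjSubgroup g '' T, quasiCentralizer H := by
  ext x
  simp only [mem_conjSubgroup, Subgroup.mem_iInf, Set.forall_mem_image,
    quasiCentralizer_conjSubgroup]

/-- A Fitting-type argument: if z fails to commute with some b in the next abelian subgroup, it is
replaced by its commutator with b. This lies in that subgroup, and still commutes with the earlier
ones because b normalises them. -/
theorem exists_ne_one_commute {T : Set (Subgroup G)} (hT : T.Finite)
    (hab : ∀ H ∈ T, ∀ x ∈ H, ∀ y ∈ H, x * y = y * x) {W : Subgroup G} (hW : W ≠ ⊥)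
    (hn : ∀ H ∈ T, ∀ w ∈ W, ∀ x ∈ H, w * x * w⁻¹ ∈ H) :
    ∃ z ∈ W, z ≠ 1 ∧ ∀ H ∈ T, ∀ x ∈ H, x ∈ W → z * x = x * z := by
  induction T, hT using Set.Finite.induction_on with
  | empty =>
    obtain ⟨z, hz⟩ := Subgroup.ne_bot_iff_exists_ne_one.1 hW
    exact ⟨z, z.2, fun h => hz (Subtype.ext h), by simp⟩
  | @insert K T _ _ ih =>
    obtain ⟨z, hzW, hz1, hz⟩ := ih (fun H hH => hab H (Or.inr hH)) fun H hH => hn H (Or.inr hH)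
    by_cases hc : ∀ x ∈ K, x ∈ W → z * x = x * z
    · refine ⟨z, hzW, hz1, ?_⟩
      rintro H (rfl | hH)
      exacts [hc, hz H hH]
    · push Not at hc
      obtain ⟨b, hbK, hbW, hb⟩ := hc
      have hz'K : z * b * z⁻¹ * b⁻¹ ∈ K :=
        K.mul_mem (hn K (Or.inl rfl) z hzW b hbK) (K.inv_mem hbK)
      refine ⟨z * b * z⁻¹ * b⁻¹, ?_, ?_, ?_⟩
      · exact W.mul_mem (W.mul_mem (W.mul_mem hzW hbW) (W.inv_mem hzW)) (W.inv_mem hbW)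
      · rwa [Ne, mul_inv_eq_one, mul_inv_eq_iff_eq_mul]
      · rintro H (rfl | hH) x hx hxW
        · exact hab _ (Or.inl rfl) _ hz'K x hx
        · have h1 : Commute z x := hz H hH x hx hxW
          have h2 : Commute z (b⁻¹ * x * b) := by
            refine hz H hH _ ?_ (W.mul_mem (W.mul_mem (W.inv_mem hbW) hxW) hbW)
            simpa using hn H (Or.inr hH) _ (W.inv_mem hbW) x hx
          have h3 : Commute (b * z⁻¹ * b⁻¹) x := by
            have := h2.inv_left.eq
            calc b * z⁻¹ * b⁻¹ * x = b * (z⁻¹ * (b⁻¹ * x * b)) * b⁻¹ := by group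
              _ = b * (b⁻¹ * x * b * z⁻¹) * b⁻¹ := by rw [this]
              _ = x * (b * z⁻¹ * b⁻¹) := by group
          have := (h1.mul_left h3).eq
          simpa [mul_assoc] using this

/-- Finitely many conjugates of δ generate G together with `U`. Their common quasi-centraliser C is
normal, and non-trivial by commutativity, hence dense. Once G is generated by `U` and finitely many
elements of C, small pieces of the conjugates generate a subgroup whose closure is normal, proper
and non-trivial. -/
theorem noAbelianLocallyNormal : NoAbelianLocallyNormal G := by
  intro δ hδ hδab
  by_contra hδ0
  obtain ⟨U, hUc, hUo⟩ := exists_compact_open_subgroup G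
  obtain ⟨T, hTf, horb, hδT, hinv, hgen⟩ := exists_finite_sup_eq_top hδ hδ0 (S := sSup)
    (fun _ _ h => sSup_le_sSup h) conjSubgroup_sSup (le_sSup rfl) hUc hUo
  have hTn : ∀ H ∈ T, IsLocallyNormal H := fun H hH => by
    obtain ⟨g, rfl⟩ := horb H hH
    exact hδ.conj g
  have hTab : ∀ H ∈ T, ∀ x ∈ H, ∀ y ∈ H, x * y = y * x := by
    intro H hH x hx y hy
    obtain ⟨g, rfl⟩ := horb H hH
    have := hδab _ (mem_conjSubgroup.1 hx) _ (mem_conjSubgroup.1 hy)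
    calc x * y = g * (g⁻¹ * x * g * (g⁻¹ * y * g)) * g⁻¹ := by group
      _ = g * (g⁻¹ * y * g * (g⁻¹ * x * g)) * g⁻¹ := by rw [this]
      _ = y * x := by group
  have hev : ∀ᶠ x in 𝓝 (1 : G), ∀ H ∈ T, ∀ y ∈ H, x * y * x⁻¹ ∈ H :=
    (eventually_all_finite hTf).2 fun H hH => (hTn H hH).eventually_conj_mem
  let C : Subgroup G := ⨅ H ∈ T, quasiCentralizer H
  have hmemC : ∀ c, c ∈ C ↔ ∀ H ∈ T, c ∈ quasiCentralizer H := by simp [C, Subgroup.mem_iInf]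
  have hCU : U ≤ conjStabilizer C := fun u hu => by
    rw [mem_conjStabilizer, conjSubgroup_iInf_quasiCentralizer, image_conjSubgroup_eq hinv hu]
  -- For b in H near 1, a⁻¹ba is the product of the commutator a⁻¹bab⁻¹, a small element of K, and
  -- b; c commutes with both factors.
  have hCT : ∀ K ∈ T, ∀ a ∈ K, ∀ c ∈ C, a * c * a⁻¹ ∈ C := by
    intro K hK a haK c hc
    rw [hmemC]
    intro H hH
    have h1 : ∀ᶠ b in 𝓝 (1 : G), a⁻¹ * b * a * b⁻¹ ∈ K →
        c * (a⁻¹ * b * a * b⁻¹) = a⁻¹ * b * a * b⁻¹ * c := by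
      have := (tendsto_commutator_one a⁻¹).eventually ((hmemC c).1 hc K hK)
      simpa using this
    filter_upwards [h1, (hmemC c).1 hc H hH, (hTn K hK).eventually_conj_mem] with b hb1 hb2 hb3 hbH
    have hb4 : a⁻¹ * b * a * b⁻¹ ∈ K := by
      have := K.mul_mem (K.inv_mem haK) (hb3 a haK)
      simpa [mul_assoc] using this
    have h5 : Commute c (a⁻¹ * b * a * b⁻¹ * b) :=
      Commute.mul_right (hb1 hb4) (hb2 hbH)
    have h6 := h5.eq
    rw [inv_mul_cancel_right] at h6
    calc a * c * a⁻¹ * b = a * (c * (a⁻¹ * b * a)) * a⁻¹ := by group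
      _ = a * (a⁻¹ * b * a * c) * a⁻¹ := by rw [h6]
      _ = b * (a * c * a⁻¹) := by group
  have hCn : C.Normal := by
    refine normal_of_conjStabilizer_eq_top (top_le_iff.1 (hgen ▸ sup_le (sSup_le ?_) hCU))
    intro K hK a ha
    exact conjSubgroup_eq_of_conj_mem (hCT K hK a ha)
      fun x hx => by simpa using hCT K hK _ (K.inv_mem ha) x hx
  have hC0 : C ≠ ⊥ := by
    obtain ⟨W, -, hWo, hW⟩ := exists_compact_open_subgroup_subset hev
    obtain ⟨z, -, hz1, hz⟩ := exists_ne_one_commute hTf hTab (ne_bot_of_isOpen hWo)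
      fun H hH w hw => hW hw H hH
    intro h0
    have : z ∈ C := (hmemC z).2 fun H hH => by
      filter_upwards [hWo.mem_nhds W.one_mem] with x hx hxH using hz H hH x hxH hx
    rw [h0] at this
    exact hz1 this
  obtain ⟨F, hF, hFC, hFgen⟩ := exists_finite_generating (topologicalClosure_eq_top hCn hC0) hUo
  obtain ⟨O, hO, hOtop⟩ := exists_mem_nhds_one_ne_univ G
  have h1 : ∀ᶠ x in 𝓝 (1 : G), ∀ f ∈ F, ∀ H ∈ T, x ∈ H → f * x = x * f :=
    (eventually_all_finite hF).2 fun f hf => (eventually_all_finite hTf).2 fun H hH =>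
      (hmemC f).1 (hFC hf) H hH
  obtain ⟨W, hWo, hWO, hUW⟩ := exists_open_subgroup_conj_mem hUc (inter_mem hO h1)
  let X : Subgroup G := (sSup ((fun H => H ⊓ W) '' T)).topologicalClosure
  have hXW : X ≤ W := by
    refine Subgroup.topologicalClosure_minimal _ (sSup_le ?_) (W.isClosed_of_isOpen hWo)
    rintro _ ⟨H, -, rfl⟩
    exact inf_le_right
  have hFX : ∀ f ∈ F, X ≤ Subgroup.centralizer {f} := by
    intro f hf
    refine Subgroup.topologicalClosure_minimal _ (sSup_le ?_) (Set.isClosed_centralizer _)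
    rintro _ ⟨H, hH, rfl⟩ x ⟨hxH, hxW⟩
    exact Subgroup.mem_centralizer_singleton_iff.2 ((hWO hxW).2 f hf H hH hxH).symm
  have hUX : ∀ u ∈ U, ∀ x ∈ X, u * x * u⁻¹ ∈ X := by
    intro u hu
    have hle : X ≤ conjSubgroup u⁻¹ X := by
      refine Subgroup.topologicalClosure_minimal _ (sSup_le ?_)
        (isClosed_conjSubgroup _ (Subgroup.isClosed_topologicalClosure _))
      rintro _ ⟨H, hH, rfl⟩ x ⟨hxH, hxW⟩
      refine mem_conjSubgroup.2 (Subgroup.le_topologicalClosure _ ?_)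
      refine Subgroup.mem_sSup_of_mem (Set.mem_image_of_mem (fun H => H ⊓ W) (hinv u hu H hH))
        (Subgroup.mem_inf.2 ⟨?_, ?_⟩)
      · rw [inv_inv]
        exact conj_mem_conjSubgroup.2 hxH
      · rw [inv_inv]
        exact hUW u hu x hxW
    intro x hx
    simpa using mem_conjSubgroup.1 (hle hx)
  have hXn : X.Normal := by
    refine normal_of_conjStabilizer_eq_top (top_le_iff.1 (hFgen ▸ closure_le_conjStabilizer ?_))
    rintro s (hs | hs)
    · have hc : ∀ x ∈ X, x * s = s * x := fun x hx =>
        Subgroup.mem_centralizer_singleton_iff.1 (hFX s hs hx)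
      refine conjSubgroup_eq_of_conj_mem (fun x hx => ?_) fun x hx => ?_
      · rwa [← hc x hx, mul_inv_cancel_right]
      · rwa [mul_assoc, hc x hx, inv_mul_cancel_left]
    · exact conjSubgroup_eq_of_forall_conj_mem hUX hs
  rcases eq_bot_or_top_of_normal hXn (Subgroup.isClosed_topologicalClosure _) with h | h
  · refine hδ0 (hδ.eq_bot_of_inf_eq_bot quasiCentralizer_top hWo (eq_bot_iff.2 ?_))
    rw [← h]
    exact (le_sSup (Set.mem_image_of_mem (fun H => H ⊓ W) hδT)).trans
      (Subgroup.le_topologicalClosure _)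
  · exact hOtop W (fun x hx => (hWO hx).1) (top_le_iff.1 (h ▸ hXW))

end ClassS

/-! ### The centraliser lattice in terms of bicommutants. -/

section CentraliserLattice

variable {G : Type*} [Group G] [TopologicalSpace G] [IsTopologicalGroup G] [IsClassS G]

/-- Every α^⊥ is the class of the trace on `U` of a quasi-centraliser, which is a bicommutant; if
only 1 and G occurred, the lattice would reduce to 0 and ∞. -/
theorem exists_isBicommutant_ne
    (hLC : centralizerLattice G ≠ {StructureLattice.zero G, StructureLattice.infty G}) :
    ∃ R : Subgroup G, IsBicommutant R ∧ R ≠ ⊥ ∧ R ≠ ⊤ := by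
  by_contra! hcon
  refine hLC (Set.Subset.antisymm ?_ ?_)
  · rintro β ⟨α, K, U, hUc, hUo, hKU, hn, -, rfl⟩
    have hUK : ∀ u ∈ U, ∀ x ∈ K.toSubgroup, u * x * u⁻¹ ∈ K.toSubgroup := fun u hu x hx =>
      (Subgroup.mem_normalizer_iff.1 (hn hu) x).1 hx
    have hK : IsLocallyNormal K.toSubgroup := .of_conj_mem K.isCompact'.isClosed hUo hUK
    have heq := quasiCentralizer_inf_eq quasiCentralizer_top noAbelianLocallyNormal hK.isClosed
      hUc hUo hUK
    rw [inf_eq_left.2 hKU] at heq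
    have hR := hK.isBicommutant_quasiCentralizer quasiCentralizer_top noAbelianLocallyNormal
    by_cases h0 : quasiCentralizer K.toSubgroup = ⊥
    · left
      rw [h0, bot_inf_eq] at heq
      refine Quotient.sound ?_
      change Subgroup.Commensurable (U ⊓ Subgroup.centralizer (K.toSubgroup : Set G)) ⊥
      rw [← heq]
    · right
      rw [hcon _ hR h0, top_inf_eq] at heq
      rw [Set.mem_singleton_iff, ← StructureLattice.mk_ofCompactOpen U hUc hUo]
      refine Quotient.sound ?_
      change Subgroup.Commensurable (U ⊓ Subgroup.centralizer (K.toSubgroup : Set G)) U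
      rw [← heq]
  · obtain ⟨U, hUc, hUo⟩ := exists_compact_open_subgroup G
    rintro β (rfl | rfl)
    · refine ⟨_, .ofCompactOpen U hUc hUo, U, hUc, hUo, le_rfl, Subgroup.le_normalizer, rfl,
        Quotient.sound ?_⟩
      change Subgroup.Commensurable ⊥ (U ⊓ Subgroup.centralizer (U : Set G))
      have : U ⊓ Subgroup.centralizer (U : Set G) = ⊥ := by
        rw [eq_bot_iff, ← quasiCentralizer_top (G := G)]
        rintro x ⟨-, hx⟩
        filter_upwards [hUo.mem_nhds U.one_mem] with u hu _
        exact (Subgroup.mem_centralizer_iff.1 hx u hu).symm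
      rw [this]
    · rw [← StructureLattice.mk_ofCompactOpen U hUc hUo]
      refine ⟨_, .trivial G, U, hUc, hUo, bot_le, ?_, rfl, Quotient.sound ?_⟩
      · change U ≤ Subgroup.normalizer ((⊥ : Subgroup G) : Set G)
        rw [Subgroup.normalizer_eq_top]
        exact le_top
      · change Subgroup.Commensurable U (U ⊓ Subgroup.centralizer ((⊥ : Subgroup G) : Set G))
        have : U ⊓ Subgroup.centralizer ((⊥ : Subgroup G) : Set G) = U := by
          refine inf_eq_left.2 fun x _ => Subgroup.mem_centralizer_iff.2 ?_
          simp
        rw [this]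

theorem isBicommutant_iInf_quasiCentralizer {T : Set (Subgroup G)} (hT : T.Finite)
    (h : ∀ H ∈ T, IsLocallyNormal H) : IsBicommutant (⨅ H ∈ T, quasiCentralizer H) := by
  induction T, hT using Set.Finite.induction_on with
  | empty => simpa using IsBicommutant.top
  | insert _ _ ih =>
    rw [iInf_insert]
    exact ((h _ (Or.inl rfl)).isBicommutant_quasiCentralizer quasiCentralizer_top
      noAbelianLocallyNormal).inf (ih fun H hH => h H (Or.inr hH))

/-- Finitely many conjugates of a non-trivial element of the centraliser lattice have join `∞`. -/
theorem IsBicommutant.exists_finite_conj_inf_ne_bot {δ : Subgroup G} (hδ : IsBicommutant δ)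
    (hδ0 : δ ≠ ⊥) :
    ∃ T : Set G, T.Finite ∧
      ∀ R : Subgroup G, IsBicommutant R → R ≠ ⊥ → ∃ t ∈ T, R ⊓ conjSubgroup t δ ≠ ⊥ := by
  obtain ⟨U, hUc, hUo⟩ := exists_compact_open_subgroup G
  -- The join in the centraliser lattice, in De Morgan form.
  let S : Set (Subgroup G) → Subgroup G := fun T =>
    quasiCentralizer (⨅ H ∈ T, quasiCentralizer H)
  have hS : Monotone S := fun T T' h => quasiCentralizer_anti (biInf_mono fun _ hH => h hH)
  have hconj : ∀ g T, conjSubgroup g (S T) = S (conjSubgroup g '' T) := fun g T => by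
    rw [← quasiCentralizer_conjSubgroup, conjSubgroup_iInf_quasiCentralizer]
  have hδS : δ ≤ S {δ} := by
    simpa [S] using hδ.le_quasiCentralizer_quasiCentralizer quasiCentralizer_top
      noAbelianLocallyNormal
  obtain ⟨T, hTf, horb, hδT, hinv, hgen⟩ :=
    exists_finite_sup_eq_top hδ.toIsLocallyNormal hδ0 hS hconj hδS hUc hUo
  have hTn : ∀ H ∈ T, IsBicommutant H := fun H hH => by
    obtain ⟨g, rfl⟩ := horb H hH
    exact hδ.conj g
  have hA := isBicommutant_iInf_quasiCentralizer hTf fun H hH => (hTn H hH).toIsLocallyNormal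
  -- The join normalises itself and `U` permutes `T`; together they generate G.
  have hSn : (S T).Normal := by
    refine normal_of_conjStabilizer_eq_top (top_le_iff.1 (hgen ▸ sup_le ?_ ?_))
    · exact fun x hx => conjSubgroup_of_mem hx
    · intro u hu
      rw [mem_conjStabilizer, hconj, image_conjSubgroup_eq hinv hu]
  have hScl := (hA.isLocallyNormal_quasiCentralizer quasiCentralizer_top
    noAbelianLocallyNormal).isClosed
  have hStop : S T = ⊤ := (eq_bot_or_top_of_normal hSn hScl).resolve_left fun h =>
    hδ0 (eq_bot_iff.2 (h ▸ hδS.trans (hS (Set.singleton_subset_iff.2 hδT))))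
  have hA0 : ⨅ H ∈ T, quasiCentralizer H = ⊥ := by
    have := hA.le_quasiCentralizer_quasiCentralizer quasiCentralizer_top noAbelianLocallyNormal
    change _ ≤ quasiCentralizer (S T) at this
    rw [hStop, quasiCentralizer_top] at this
    exact eq_bot_iff.2 this
  choose! t ht using horb
  refine ⟨t '' T, hTf.image t, fun R hR hR0 => ?_⟩
  by_contra! hcon
  refine hR0 (eq_bot_iff.2 (hA0 ▸ le_iInf₂ fun H hH => ?_))
  refine hR.le_quasiCentralizer_of_inf_eq_bot quasiCentralizer_top noAbelianLocallyNormal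
    (hTn H hH) ?_
  have := hcon _ (Set.mem_image_of_mem t hH)
  rwa [← ht H hH] at this

/-! ### Dynamics of conjugation on bicommutants. -/

theorem inf_conjSubgroup_eq_bot_comm {x : G} {R : Subgroup G}
    (h : conjSubgroup x⁻¹ R ⊓ R = ⊥) : conjSubgroup x R ⊓ R = ⊥ := by
  have := congrArg (conjSubgroup x) h
  rwa [conjSubgroup_inf, conjSubgroup_conjSubgroup_inv, conjSubgroup_bot, inf_comm] at this

/-- Every non-trivial group element displaces some non-trivial element of the centraliser
lattice. -/
theorem exists_isBicommutant_displaced {R₀ : Subgroup G} (hR₀ : IsBicommutant R₀) (h0 : R₀ ≠ ⊥)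
    (h1 : R₀ ≠ ⊤) {x : G} (hx : x ≠ 1) :
    ∃ R : Subgroup G, IsBicommutant R ∧ R ≠ ⊥ ∧ conjSubgroup x R ⊓ R = ⊥ := by
  -- The kernel of the action on bicommutants is closed and normal; it is not G, since otherwise
  -- `R₀` would be normal.
  let N : Subgroup G := ⨅ R : {R : Subgroup G // IsBicommutant R}, conjStabilizer R.1
  have hmem : ∀ g, g ∈ N ↔ ∀ R : Subgroup G, IsBicommutant R → conjSubgroup g R = R := by
    simp [N, Subgroup.mem_iInf, mem_conjStabilizer]
  have hNn : N.Normal := by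
    refine ⟨fun n hn g => (hmem _).2 fun R hR => ?_⟩
    rw [conjSubgroup_mul, conjSubgroup_mul, (hmem n).1 hn _ (hR.conj g⁻¹),
      conjSubgroup_conjSubgroup_inv]
  have hNc : IsClosed (N : Set G) := by
    rw [Subgroup.coe_iInf]
    exact isClosed_iInter fun R => isClosed_conjStabilizer R.2.isClosed
  have hN : N = ⊥ := by
    refine (eq_bot_or_top_of_normal hNn hNc).resolve_right fun h => ?_
    have hn : R₀.Normal := normal_of_conjStabilizer_eq_top (top_le_iff.1 fun g _ =>
      (hmem g).1 (h ▸ Subgroup.mem_top g) R₀ hR₀)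
    exact (eq_bot_or_top_of_normal hn hR₀.isClosed).elim h0 h1
  have hxN : x ∉ N := by rwa [hN, Subgroup.mem_bot]
  rw [hmem] at hxN
  push Not at hxN
  obtain ⟨R, hR, hne⟩ := hxN
  have hq := quasiCentralizer_top (G := G)
  have ha := noAbelianLocallyNormal (G := G)
  have key : ∀ (y : G) (R : Subgroup G), IsBicommutant R → ¬ R ≤ conjSubgroup y R →
      ∃ R : Subgroup G, IsBicommutant R ∧ R ≠ ⊥ ∧ conjSubgroup y R ⊓ R = ⊥ := by
    intro y R hR hle
    have hyR := hR.conj y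
    -- The image of this subgroup under y lies in yRy⁻¹, which meets its own quasi-centraliser
    -- trivially.
    refine ⟨R ⊓ quasiCentralizer (conjSubgroup y R),
      hR.inf (hyR.isBicommutant_quasiCentralizer hq ha),
      fun h => hle (hR.le_of_inf_quasiCentralizer_eq_bot hq ha hyR h), ?_⟩
    rw [eq_bot_iff, ← hyR.inf_quasiCentralizer hq ha]
    exact inf_le_inf (conjSubgroup_mono y inf_le_left) inf_le_right
  by_cases hle : R ≤ conjSubgroup x R
  · have hle' : ¬ R ≤ conjSubgroup x⁻¹ R := fun h => by
      have := conjSubgroup_mono x h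
      rw [conjSubgroup_conjSubgroup_inv] at this
      exact hne (le_antisymm this hle)
    obtain ⟨S, hS, hS0, hS1⟩ := key _ R hR hle'
    exact ⟨S, hS, hS0, inf_conjSubgroup_eq_bot_comm hS1⟩
  · exact key x R hR hle

/-- An element of `R` quasi-centralising `S` commutes with x, so it is fixed by a conjugation that
moves `R` off itself. -/
theorem IsBicommutant.le_of_displaced {R S : Subgroup G} (hR : IsBicommutant R)
    (hS : IsBicommutant S) {x : G} (hx : x ∈ S) (h : conjSubgroup x R ⊓ R = ⊥) : R ≤ S := by
  have hq := quasiCentralizer_top (G := G)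
  have ha := noAbelianLocallyNormal (G := G)
  refine hR.le_of_inf_quasiCentralizer_eq_bot hq ha hS (eq_bot_iff.2 ?_)
  rw [← h]
  rintro t ⟨htR, htS⟩
  have := hS.commute hq ha hx htS
  refine ⟨mem_conjSubgroup.2 ?_, htR⟩
  rwa [mul_assoc, ← this, inv_mul_cancel_left]

/-- Displacing a given bicommutant is an open condition, so finitely many displaced ones serve the
compact set Q minus the interior of O; an element of `S` there forces one of them into `S`. -/
theorem exists_finite_of_not_subset {R₀ : Subgroup G} (hR₀ : IsBicommutant R₀) (h0 : R₀ ≠ ⊥)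
    (h1 : R₀ ≠ ⊤) {Q O : Set G} (hQ : IsCompact Q) (hO : O ∈ 𝓝 (1 : G)) :
    ∃ Δ : Set (Subgroup G), Δ.Finite ∧ (∀ δ ∈ Δ, IsBicommutant δ ∧ δ ≠ ⊥) ∧
      ∀ S : Subgroup G, IsBicommutant S → ¬ (S : Set G) ∩ Q ⊆ O → ∃ δ ∈ Δ, δ ≤ S := by
  choose! R hR hR0 hdisp using fun (x : G) (hx : x ≠ 1) =>
    exists_isBicommutant_displaced hR₀ h0 h1 hx
  have hQO : IsCompact (Q \ interior O) := hQ.diff isOpen_interior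
  have hne : ∀ x ∈ Q \ interior O, x ≠ 1 := by
    rintro x hx rfl
    exact hx.2 (mem_interior_iff_mem_nhds.2 hO)
  have hn : ∀ x ∈ Q \ interior O, {y | conjSubgroup y (R x) ⊓ R x = ⊥} ∈ 𝓝 x := by
    intro x hx
    have : Tendsto (fun y : G => x⁻¹ * y) (𝓝 x) (𝓝 1) := by
      have h : Continuous fun y : G => x⁻¹ * y := by fun_prop
      simpa using h.tendsto x
    filter_upwards [this.eventually (hR x (hne x hx)).eventually_conjSubgroup_eq] with y hy
    have h2 : y = x * (x⁻¹ * y) := by group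
    rw [h2, conjSubgroup_mul, hy]
    exact hdisp x (hne x hx)
  obtain ⟨t, htQ, ht⟩ := hQO.elim_nhds_subcover _ hn
  refine ⟨R '' t, t.finite_toSet.image R, ?_, fun S hS hSO => ?_⟩
  · rintro _ ⟨x, hx, rfl⟩
    have := hne x (htQ x hx)
    exact ⟨hR x this, hR0 x this⟩
  · obtain ⟨y, ⟨hyS, hyQ⟩, hyO⟩ := Set.not_subset.1 hSO
    obtain ⟨x, hx, hxy⟩ := Set.mem_iUnion₂.1 (ht ⟨hyQ, fun h => hyO (interior_subset h)⟩)
    exact ⟨R x, ⟨x, hx, rfl⟩, (hR x (hne x (htQ x hx))).le_of_displaced hS hyS hxy⟩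

/-- Otherwise a finite list meets the down-set of every non-trivial bicommutant, so there is an
atom, and all its conjugates are in the list. An open normal subgroup then fixes its orbit, so the
atom is normal and equals G, which `R₀` rules out. -/
theorem exists_isBicommutant_inter_subset {R₀ : Subgroup G} (hR₀ : IsBicommutant R₀)
    (h0 : R₀ ≠ ⊥) (h1 : R₀ ≠ ⊤) {Q O : Set G} (hQ : IsCompact Q) (hO : O ∈ 𝓝 (1 : G)) :
    ∃ α : Subgroup G, IsBicommutant α ∧ α ≠ ⊥ ∧ (α : Set G) ∩ Q ⊆ O := by
  by_contra! hcon
  obtain ⟨Δ, hΔf, hΔ, hΔS⟩ := exists_finite_of_not_subset hR₀ h0 h1 hQ hO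
  have hΔS' : ∀ S : Subgroup G, IsBicommutant S → S ≠ ⊥ → ∃ δ ∈ Δ, δ ≤ S :=
    fun S hS hS0 => hΔS S hS (hcon S hS hS0)
  have hΔne : Δ.Nonempty := by
    obtain ⟨δ, hδ, -⟩ := hΔS' R₀ hR₀ h0
    exact ⟨δ, hδ⟩
  obtain ⟨A, hA⟩ := hΔf.exists_minimal hΔne
  have hatom : ∀ S : Subgroup G, IsBicommutant S → S ≠ ⊥ → S ≤ A → A = S ∧ S ∈ Δ := by
    intro S hS hS0 hSA
    obtain ⟨δ, hδ, hδS⟩ := hΔS' S hS hS0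
    have h2 := hA.2 hδ (hδS.trans hSA)
    have h3 := le_antisymm (h2.trans hδS) hSA
    exact ⟨h3, h3 ▸ hA.1⟩
  have horb : ∀ g, conjSubgroup g A ∈ Δ := by
    intro g
    obtain ⟨δ, hδ, hδA⟩ := hΔS' _ ((hΔ A hA.1).1.conj g)
      fun h => (hΔ A hA.1).2 (conjSubgroup_eq_bot.1 h)
    have h2 := conjSubgroup_mono g⁻¹ hδA
    rw [conjSubgroup_inv_conjSubgroup] at h2
    have h3 := (hatom _ ((hΔ δ hδ).1.conj g⁻¹)
      (fun h => (hΔ δ hδ).2 (conjSubgroup_eq_bot.1 h)) h2).1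
    rw [h3, conjSubgroup_conjSubgroup_inv]
    exact hδ
  let N : Subgroup G := ⨅ g, conjStabilizer (conjSubgroup g A)
  have hmem : ∀ x, x ∈ N ↔ ∀ g, conjSubgroup x (conjSubgroup g A) = conjSubgroup g A := by
    simp [N, Subgroup.mem_iInf, mem_conjStabilizer]
  have hNn : N.Normal := by
    refine ⟨fun n hn g => (hmem _).2 fun k => ?_⟩
    rw [conjSubgroup_mul, conjSubgroup_mul, ← conjSubgroup_mul g⁻¹ k, (hmem n).1 hn,
      conjSubgroup_mul, conjSubgroup_conjSubgroup_inv]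
  have hNo : IsOpen (N : Set G) := by
    refine Subgroup.isOpen_of_mem_nhds _ (g := 1) ?_
    have : ∀ᶠ u in 𝓝 (1 : G), ∀ δ ∈ Δ, conjSubgroup u δ = δ :=
      (eventually_all_finite hΔf).2 fun δ hδ => (hΔ δ hδ).1.eventually_conjSubgroup_eq
    filter_upwards [this] with u hu
    exact (hmem u).2 fun g => hu _ (horb g)
  have hNtop := (eq_bot_or_top_of_normal hNn (N.isClosed_of_isOpen hNo)).resolve_left
    (ne_bot_of_isOpen hNo)
  have hAn : A.Normal := normal_of_conjStabilizer_eq_top (top_le_iff.1 fun g _ => by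
    have := (hmem g).1 (hNtop ▸ Subgroup.mem_top g) 1
    rwa [conjSubgroup_one] at this)
  have hAtop := (eq_bot_or_top_of_normal hAn (hΔ A hA.1).1.isClosed).resolve_left (hΔ A hA.1).2
  have := (hatom R₀ hR₀ h0 (hAtop ▸ le_top)).1
  exact h1 (this ▸ hAtop)

/-- A sufficiently small bicommutant meets one of finitely many conjugates of `R`; the intersection
is conjugated back, with Q and O adjusted beforehand to the finitely many conjugators. -/
theorem IsBicommutant.exists_le_inter_subset {R : Subgroup G} (hR : IsBicommutant R)
    (hR0 : R ≠ ⊥) {R₀ : Subgroup G} (hR₀ : IsBicommutant R₀) (h0 : R₀ ≠ ⊥) (h1 : R₀ ≠ ⊤)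
    {Q O : Set G} (hQ : IsCompact Q) (hO : O ∈ 𝓝 (1 : G)) :
    ∃ α ≤ R, IsBicommutant α ∧ α ≠ ⊥ ∧ (α : Set G) ∩ Q ⊆ O := by
  obtain ⟨T, hTf, hT⟩ := hR.exists_finite_conj_inf_ne_bot hR0
  have hQ' : IsCompact (⋃ t ∈ T, (fun x => t * x * t⁻¹) '' Q) :=
    hTf.isCompact_biUnion fun t _ => hQ.image (by fun_prop)
  have hO' : ∀ᶠ x in 𝓝 (1 : G), ∀ t ∈ T, t⁻¹ * x * t ∈ O :=
    (eventually_all_finite hTf).2 fun t _ => tendsto_inv_conj_one t hO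
  obtain ⟨α, hα, hα0, hαQ⟩ := exists_isBicommutant_inter_subset hR₀ h0 h1 hQ' hO'
  obtain ⟨t, ht, hαt⟩ := hT α hα hα0
  refine ⟨conjSubgroup t⁻¹ (α ⊓ conjSubgroup t R), ?_, (hα.inf (hR.conj t)).conj t⁻¹,
    fun h => hαt (conjSubgroup_eq_bot.1 h), ?_⟩
  · rw [conjSubgroup_inf, conjSubgroup_inv_conjSubgroup]
    exact inf_le_right
  · rintro x ⟨hx, hxQ⟩
    have h2 := (mem_conjSubgroup.1 hx).1
    rw [inv_inv] at h2
    have h3 := hαQ ⟨h2, Set.mem_biUnion ht ⟨x, hxQ, rfl⟩⟩ t ht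
    simpa [mul_assoc] using h3

/-- There are a compact open subgroup `U`, a group element `g` and a non-trivial element `δ` of
the centraliser lattice such that `g` shrinks `δ` and conjugation by `g` matches the traces on `U`
of `δ` and of its image. -/
theorem exists_skewering {R₀ : Subgroup G} (hR₀ : IsBicommutant R₀) (h0 : R₀ ≠ ⊥)
    (h1 : R₀ ≠ ⊤) :
    ∃ (U : Subgroup G) (g : G) (δ : Subgroup G), IsCompact (U : Set G) ∧ IsOpen (U : Set G) ∧
      IsBicommutant δ ∧ conjSubgroup g δ ≤ δ ∧ ¬ δ ≤ conjSubgroup g δ ∧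
      ∀ x ∈ δ, x ∈ U ↔ g * x * g⁻¹ ∈ U := by
  obtain ⟨O₁, hO₁, hO₁top⟩ := exists_mem_nhds_one_ne_univ G
  obtain ⟨U, hUc, hUo, hUO⟩ := exists_compact_open_subgroup_subset hO₁
  have hUtop := hO₁top U hUO
  obtain ⟨S₀, hS₀, hgen₀⟩ := IsClassS.compactlyGenerated (G := G)
  let S : Set G := insert 1 (S₀ ∪ S₀⁻¹)
  have hS : IsCompact S := (hS₀.union hS₀.inv).insert 1
  have hSinv : ∀ s ∈ S, s⁻¹ ∈ S := by
    rintro s (rfl | hs | hs)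
    · simp [S]
    · exact Or.inr (Or.inr (by simpa using hs))
    · exact Or.inr (Or.inl hs)
  have hgen : Subgroup.closure S = ⊤ := top_le_iff.1 (hgen₀ ▸ Subgroup.closure_mono
    (Set.subset_union_left.trans (Set.subset_insert _ _)))
  let V : Set G := {v | ∀ s ∈ S, s * v * s⁻¹ ∈ U}
  have hV : V ∈ 𝓝 (1 : G) := eventually_conj_mem_of_isCompact hS (hUo.mem_nhds U.one_mem)
  have hVU : ∀ v ∈ V, v ∈ U := fun v hv => by simpa using hv 1 (Or.inl rfl)
  let small : Subgroup G → Prop := fun R => (R : Set G) ∩ U ⊆ V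
  -- Conjugation by a generator preserves the trace on `U` between small elements.
  have hstep : ∀ (R : Subgroup G) (s : G), s ∈ S → small R → small (conjSubgroup s R) →
      ∀ x ∈ R, x ∈ U ↔ s * x * s⁻¹ ∈ U := by
    intro R s hs hR hsR x hx
    refine ⟨fun h => hR ⟨hx, h⟩ s hs, fun h => ?_⟩
    have := hsR ⟨conj_mem_conjSubgroup.2 hx, h⟩ s⁻¹ (hSinv s hs)
    simpa [mul_assoc] using this
  -- If no walk along generators left the small elements, `α ⊓ U` would lie in the normal core of
  -- `U`, which is trivial.
  have hexpand : ∀ α : Subgroup G, IsBicommutant α → α ≠ ⊥ → small α →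
      ∃ h : G, ∃ s ∈ S, (∀ x ∈ α, x ∈ U ↔ h * x * h⁻¹ ∈ U) ∧ small (conjSubgroup h α) ∧
        ¬ small (conjSubgroup (s * h) α) := by
    intro α hα hα0 hαs
    by_contra! hcon
    have hall : ∀ h : G, (∀ x ∈ α, x ∈ U ↔ h * x * h⁻¹ ∈ U) ∧ small (conjSubgroup h α) := by
      intro h
      have hmul : ∀ s ∈ S, ∀ h : G,
          ((∀ x ∈ α, x ∈ U ↔ h * x * h⁻¹ ∈ U) ∧ small (conjSubgroup h α)) →
          (∀ x ∈ α, x ∈ U ↔ s * h * x * (s * h)⁻¹ ∈ U) ∧ small (conjSubgroup (s * h) α) := by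
        rintro s hs h ⟨ht, hsm⟩
        have hsm' := hcon h s hs ht hsm
        refine ⟨fun x hx => ?_, hsm'⟩
        rw [conjSubgroup_mul] at hsm'
        rw [ht x hx, hstep _ s hs hsm hsm' _ (conj_mem_conjSubgroup.2 hx)]
        simp [mul_assoc]
      have hh : h ∈ Subgroup.closure S := hgen ▸ Subgroup.mem_top h
      induction hh using Subgroup.closure_induction_left with
      | one => simpa using hαs
      | mul_left s hs h _ ih => exact hmul s hs h ih
      | inv_mul_cancel s hs h _ ih => exact hmul s⁻¹ (hSinv s hs) h ih
    let N : Subgroup G := coreIn ⊤ U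
    have hNn : N.Normal := by
      refine ⟨fun n hn g u _ => ?_⟩
      have := hn (u * g) trivial
      simpa [mul_assoc] using this
    have hNc : IsClosed (N : Set G) := by
      have : (N : Set G) = ⋂ g : G, {x | g * x * g⁻¹ ∈ (U : Set G)} := by
        ext x
        simp [N, coreIn]
      rw [this]
      exact isClosed_iInter fun g => (U.isClosed_of_isOpen hUo).preimage (by fun_prop)
    have hNU : N ≤ U := fun x hx => by simpa using hx 1 trivial
    have hαN : α ⊓ U ≤ N := fun x hx h _ => ((hall h).1 x hx.1).1 hx.2
    rcases eq_bot_or_top_of_normal hNn hNc with hN | hN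
    · exact hα0 (hα.eq_bot_of_inf_eq_bot quasiCentralizer_top hUo (eq_bot_iff.2 (hN ▸ hαN)))
    · exact hUtop (top_le_iff.1 (hN ▸ hNU))
  -- Which member of Δ the expanded α will contain is unknown in advance, so α is chosen below a
  -- conjugate of a small element under every member.
  obtain ⟨Δ, hΔf, hΔ, hΔS⟩ := exists_finite_of_not_subset hR₀ h0 h1 hUc hV
  choose! δ' hδ'le hδ'b hδ'0 hδ's using fun (δ : Subgroup G) (hδ : δ ∈ Δ) =>
    (hΔ δ hδ).1.exists_le_inter_subset (hΔ δ hδ).2 hR₀ h0 h1 hUc hV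
  choose! T hTf hT using fun (δ : Subgroup G) (hδ : δ ∈ Δ) =>
    (hδ'b δ hδ).exists_finite_conj_inf_ne_bot (hδ'0 δ hδ)
  let T' : Set G := ⋃ δ ∈ Δ, T δ
  have hT'f : T'.Finite := hΔf.biUnion hTf
  -- Including the conjugates tUt⁻¹ gives the converse direction of `e3`.
  have hQ : IsCompact ((U : Set G) ∪ ⋃ t ∈ T', (fun x => t * x * t⁻¹) '' (U : Set G)) :=
    hUc.union (hT'f.isCompact_biUnion fun t _ => hUc.image (by fun_prop))
  have hO : {x | x ∈ V ∧ ∀ t ∈ T', t⁻¹ * x * t ∈ U} ∈ 𝓝 (1 : G) :=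
    inter_mem hV ((eventually_all_finite hT'f).2 fun t _ =>
      tendsto_inv_conj_one t (hUo.mem_nhds U.one_mem))
  obtain ⟨α₀, hα₀, hα₀0, hα₀Q⟩ := exists_isBicommutant_inter_subset hR₀ h0 h1 hQ hO
  have hα : ∀ D : Set (Subgroup G), D.Finite → D ⊆ Δ → ∃ α ≤ α₀, IsBicommutant α ∧ α ≠ ⊥ ∧
      ∀ δ ∈ D, ∃ t ∈ T δ, α ≤ conjSubgroup t (δ' δ) := by
    intro D hD
    induction D, hD using Set.Finite.induction_on with
    | empty => exact fun _ => ⟨α₀, le_rfl, hα₀, hα₀0, by simp⟩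
    | @insert δ D _ _ ih =>
      intro hDΔ
      obtain ⟨hδ, hD⟩ := Set.insert_subset_iff.1 hDΔ
      obtain ⟨α, hle, hαb, hα0, hαD⟩ := ih hD
      obtain ⟨t, ht, hne⟩ := hT δ hδ α hαb hα0
      refine ⟨α ⊓ conjSubgroup t (δ' δ), inf_le_left.trans hle,
        hαb.inf ((hδ'b δ hδ).conj t), hne, ?_⟩
      rintro ε (rfl | hε)
      · exact ⟨t, ht, inf_le_right⟩
      · obtain ⟨r, hr, hle'⟩ := hαD ε hε
        exact ⟨r, hr, inf_le_left.trans hle'⟩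
  obtain ⟨α, hαle, hαb, hα0, hαΔ⟩ := hα Δ hΔf subset_rfl
  have hαQ := (Set.inter_subset_inter_left _ (SetLike.coe_subset_coe.2 hαle)).trans hα₀Q
  have hαs : small α := fun x hx => (hαQ ⟨hx.1, Or.inl hx.2⟩).1
  obtain ⟨h, s, hs, htame, hhs, hns⟩ := hexpand α hαb hα0 hαs
  obtain ⟨ε, hε, hεα⟩ := hΔS _ (hαb.conj _) hns
  obtain ⟨t, ht, hαt⟩ := hαΔ ε hε
  have ht' : t ∈ T' := Set.mem_biUnion hε ht
  set δ := δ' ε with hδdef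
  have hδα : δ ≤ conjSubgroup (s * h) α := (hδ'le ε hε).trans hεα
  have hδα' : conjSubgroup (s * h)⁻¹ δ ≤ α := by
    simpa only [conjSubgroup_inv_conjSubgroup] using conjSubgroup_mono (s * h)⁻¹ hδα
  have hαδ : conjSubgroup t⁻¹ α ≤ δ := by
    simpa using conjSubgroup_mono t⁻¹ hαt
  have hδs : small δ := hδ's ε hε
  -- (sh)⁻¹ carries δ into α, and t⁻¹ carries α into δ. If the image were all of δ, the sh-conjugate
  -- of α would lie in the small δ, hence be small.
  refine ⟨U, t⁻¹ * (s * h)⁻¹, δ, hUc, hUo, hδ'b ε hε, ?_, ?_, ?_⟩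
  · rw [conjSubgroup_mul]
    exact (conjSubgroup_mono _ hδα').trans hαδ
  · intro hle
    rw [conjSubgroup_mul] at hle
    have h2 : conjSubgroup t⁻¹ α ≤ conjSubgroup t⁻¹ (conjSubgroup (s * h)⁻¹ δ) :=
      hαδ.trans hle
    have h3 := conjSubgroup_mono t h2
    rw [conjSubgroup_conjSubgroup_inv, conjSubgroup_conjSubgroup_inv] at h3
    have h4 := conjSubgroup_mono (s * h) h3
    rw [conjSubgroup_conjSubgroup_inv] at h4
    exact hns ((Set.inter_subset_inter_left _ (SetLike.coe_subset_coe.2 h4)).trans hδs)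
  · intro x hx
    have hx2 : (s * h)⁻¹ * x * (s * h) ∈ α := mem_conjSubgroup.1 (hδα hx)
    have hx1 : s⁻¹ * x * s ∈ conjSubgroup h α := by
      rw [mem_conjSubgroup]
      simpa [mul_assoc] using hx2
    -- `hstep` is unavailable for the sh-conjugate of α, which is not small: smallness of δ gives
    -- one direction, that of the h-conjugate the other.
    have e1 : x ∈ U ↔ s⁻¹ * x * s ∈ U := by
      refine ⟨fun hxU => ?_, fun hxU => ?_⟩
      · simpa using hδs ⟨hx, hxU⟩ s⁻¹ (hSinv s hs)
      · simpa [mul_assoc] using hhs ⟨hx1, hxU⟩ s hs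
    have e2 := htame _ hx2
    have e3 : ∀ y ∈ α, y ∈ U ↔ t⁻¹ * y * t ∈ U := by
      refine fun y hy => ⟨fun hyU => (hαQ ⟨hy, Or.inl hyU⟩).2 t ht', fun hyU => ?_⟩
      refine hVU y (hαQ ⟨hy, Or.inr (Set.mem_biUnion ht' ⟨_, hyU, ?_⟩)⟩).1
      simp [mul_assoc]
    have e4 : h * ((s * h)⁻¹ * x * (s * h)) * h⁻¹ = s⁻¹ * x * s := by group
    have e5 : t⁻¹ * (s * h)⁻¹ * x * (t⁻¹ * (s * h)⁻¹)⁻¹ =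
        t⁻¹ * ((s * h)⁻¹ * x * (s * h)) * t := by group
    rw [e5, ← e3 _ hx2, e2, e4, e1]

end CentraliserLattice

/-! ### Contraction groups, and consequences of their closedness. -/

section Contraction

variable {G : Type*} [Group G] [TopologicalSpace G] [IsTopologicalGroup G]

theorem mem_contractionGroup {g x : G} :
    x ∈ contractionGroup g ↔ Tendsto (fun n : ℕ => g ^ n * x * (g ^ n)⁻¹) atTop (𝓝 1) := Iff.rfl

theorem conj_mem_contractionGroup {g x : G} (hx : x ∈ contractionGroup g) (h : G)
    (hh : Commute h g) : h * x * h⁻¹ ∈ contractionGroup g := by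
  rw [mem_contractionGroup] at *
  refine ((tendsto_conj_one h).comp hx).congr fun n => ?_
  have h1 : h * g ^ n = g ^ n * h := (hh.pow_right n).eq
  have h2 : (g ^ n)⁻¹ * h⁻¹ = h⁻¹ * (g ^ n)⁻¹ := by rw [← mul_inv_rev, ← mul_inv_rev, h1]
  calc h * (g ^ n * x * (g ^ n)⁻¹) * h⁻¹ = (h * g ^ n) * x * ((g ^ n)⁻¹ * h⁻¹) := by group
    _ = (g ^ n * h) * x * (h⁻¹ * (g ^ n)⁻¹) := by rw [h1, h2]
    _ = g ^ n * (h * x * h⁻¹) * (g ^ n)⁻¹ := by group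

/-- The elements of the contraction group of `g` whose forward orbit stays in `U`. -/
def contractionIn (g : G) (U : Subgroup G) : Subgroup G where
  carrier := {x | x ∈ contractionGroup g ∧ ∀ n : ℕ, g ^ n * x * (g ^ n)⁻¹ ∈ U}
  mul_mem' := by
    rintro a b ⟨ha, ha'⟩ ⟨hb, hb'⟩
    refine ⟨Subgroup.mul_mem _ ha hb, fun n => ?_⟩
    simpa [mul_assoc] using U.mul_mem (ha' n) (hb' n)
  one_mem' := ⟨Subgroup.one_mem _, fun n => by simp⟩
  inv_mem' := by
    rintro a ⟨ha, ha'⟩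
    refine ⟨Subgroup.inv_mem _ ha, fun n => ?_⟩
    simpa [mul_assoc] using U.inv_mem (ha' n)

theorem mem_contractionIn {g x : G} {U : Subgroup G} : x ∈ contractionIn g U ↔
    x ∈ contractionGroup g ∧ ∀ n : ℕ, g ^ n * x * (g ^ n)⁻¹ ∈ U := Iff.rfl

theorem contractionIn_le (g : G) (U : Subgroup G) : contractionIn g U ≤ U :=
  fun x hx => by simpa using hx.2 0

theorem conj_mem_contractionIn {g x : G} {U : Subgroup G} (hx : x ∈ contractionIn g U) :
    g * x * g⁻¹ ∈ contractionIn g U := by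
  refine ⟨conj_mem_contractionGroup hx.1 g (Commute.refl g), fun n => ?_⟩
  have := hx.2 (n + 1)
  rw [pow_succ] at this
  simpa [mul_assoc] using this

theorem isClosed_contractionIn {g : G} (hg : IsClosed (contractionGroup g : Set G))
    {U : Subgroup G} (hU : IsClosed (U : Set G)) : IsClosed (contractionIn g U : Set G) := by
  have : (contractionIn g U : Set G) = (contractionGroup g : Set G) ∩
      ⋂ n : ℕ, {x | g ^ n * x * (g ^ n)⁻¹ ∈ (U : Set G)} := by
    ext x
    simp [mem_contractionIn]
  rw [this]
  exact hg.inter (isClosed_iInter fun n => hU.preimage (by fun_prop))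

/-- The injection of coset spaces K/(K ∩ H) → L/(L ∩ H) is bijective by counting, so L = K(L ∩ H).
-/
theorem exists_inv_mul_mem_of_relIndex_eq {H K L : Subgroup G} (hKL : K ≤ L)
    (h : H.relIndex L ≤ H.relIndex K) (h0 : H.relIndex L ≠ 0) :
    ∀ x ∈ L, ∃ a ∈ K, a⁻¹ * x ∈ H := by
  intro x hx
  have : (H.subgroupOf L).FiniteIndex := ⟨h0⟩
  have : Finite (L ⧸ H.subgroupOf L) := Subgroup.finite_quotient_of_finiteIndex
  obtain ⟨q, hq⟩ := (Function.Injective.bijective_of_nat_card_le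
    (Subgroup.quotientSubgroupOfEmbeddingOfLE H hKL).injective h).2 (QuotientGroup.mk ⟨x, hx⟩)
  obtain ⟨a, rfl⟩ := QuotientGroup.mk_surjective q
  rw [Subgroup.quotientSubgroupOfEmbeddingOfLE_apply_mk, QuotientGroup.eq,
    Subgroup.mem_subgroupOf] at hq
  exact ⟨a, a.2, hq⟩

section LocallyCompact

variable [LocallyCompactSpace G] [TotallyDisconnectedSpace G]

/-- A closed con(g) is locally compact, hence Baire, so orbits stay in `U` from a common time N on
some open piece, which is translated to 1; the finitely many earlier times are handled by
continuity. -/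
theorem eventually_mem_contractionIn {g : G} (hg : IsClosed (contractionGroup g : Set G))
    {U : Subgroup G} (hU : IsOpen (U : Set G)) :
    ∀ᶠ x in 𝓝 (1 : G), x ∈ contractionGroup g → x ∈ contractionIn g U := by
  have hUcl := U.isClosed_of_isOpen hU
  have : LocallyCompactSpace (contractionGroup g) :=
    hg.isClosedEmbedding_subtypeVal.locallyCompactSpace
  let f : ℕ → Set (contractionGroup g) := fun N =>
    {x | ∀ n, N ≤ n → g ^ n * (x : G) * (g ^ n)⁻¹ ∈ U}
  have hf : ∀ N, IsClosed (f N) := by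
    intro N
    have : f N = ⋂ n, ⋂ (_ : N ≤ n),
        {x : contractionGroup g | g ^ n * (x : G) * (g ^ n)⁻¹ ∈ (U : Set G)} := by
      ext x
      simp [f]
    rw [this]
    exact isClosed_iInter fun n => isClosed_iInter fun _ => hUcl.preimage (by fun_prop)
  have hcover : ⋃ N, f N = Set.univ := by
    refine Set.eq_univ_of_forall fun x => Set.mem_iUnion.2 ?_
    obtain ⟨N, hN⟩ := eventually_atTop.1 ((mem_contractionGroup.1 x.2) (hU.mem_nhds U.one_mem))
    exact ⟨N, hN⟩
  obtain ⟨N, x, hx⟩ := nonempty_interior_of_iUnion_of_closed hf hcover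
  have hxf := interior_subset hx
  have h1 : ∀ᶠ y in 𝓝 (1 : contractionGroup g), x * y ∈ f N := by
    have hc : Continuous fun y : contractionGroup g => x * y := by fun_prop
    have := hc.tendsto 1
    rw [mul_one] at this
    exact this (mem_interior_iff_mem_nhds.1 hx)
  rw [nhds_subtype, eventually_comap] at h1
  have h2 : ∀ᶠ y in 𝓝 (1 : G), ∀ n ∈ Set.Iio N, g ^ n * y * (g ^ n)⁻¹ ∈ U :=
    (eventually_all_finite (Set.finite_Iio N)).2 fun n _ =>
      tendsto_conj_one (g ^ n) (hU.mem_nhds U.one_mem)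
  filter_upwards [h1, h2] with y hy1 hy2 hyC
  refine ⟨hyC, fun n => ?_⟩
  rcases lt_or_ge n N with hn | hn
  · exact hy2 n hn
  · have := U.mul_mem (U.inv_mem (hxf n hn)) (hy1 ⟨y, hyC⟩ rfl n hn)
    simpa [mul_assoc] using this

/-- Contraction is uniform on compact sets: cosets of `contractionIn g U` are neighbourhoods in
con(g), and one threshold works on each. -/
theorem eventually_conj_pow_mem {g : G} (hg : IsClosed (contractionGroup g : Set G)) {Q : Set G}
    (hQ : IsCompact Q) (hQg : Q ⊆ contractionGroup g) {O : Set G} (hO : O ∈ 𝓝 (1 : G)) :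
    ∃ n : ℕ, ∀ x ∈ Q, g ^ n * x * (g ^ n)⁻¹ ∈ O := by
  obtain ⟨U, -, hUo, hUO⟩ := exists_compact_open_subgroup_subset hO
  have hN : ∀ x : G, ∃ N : ℕ, x ∈ Q → ∀ n, N ≤ n → g ^ n * x * (g ^ n)⁻¹ ∈ U := by
    intro x
    by_cases hx : x ∈ Q
    · obtain ⟨N, hN⟩ :=
        eventually_atTop.1 ((mem_contractionGroup.1 (hQg hx)) (hUo.mem_nhds U.one_mem))
      exact ⟨N, fun _ => hN⟩
    · exact ⟨0, fun h => absurd h hx⟩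
  choose N hN using hN
  have hn : ∀ x ∈ Q, {y | y ∈ contractionGroup g →
      ∀ n, N x ≤ n → g ^ n * y * (g ^ n)⁻¹ ∈ U} ∈ 𝓝 x := by
    intro x hx
    have ht : Tendsto (fun y : G => x⁻¹ * y) (𝓝 x) (𝓝 1) := by
      have h : Continuous fun y : G => x⁻¹ * y := by fun_prop
      simpa using h.tendsto x
    filter_upwards [ht.eventually (eventually_mem_contractionIn hg hUo)] with y hy hyC n hn
    have h1 := (hy (Subgroup.mul_mem _ (Subgroup.inv_mem _ (hQg hx)) hyC)).2 n
    simpa [mul_assoc] using U.mul_mem (hN x hx n hn) h1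
  obtain ⟨t, -, ht⟩ := hQ.elim_nhds_subcover _ hn
  refine ⟨t.sup N, fun y hy => hUO ?_⟩
  obtain ⟨x, hx, hxy⟩ := Set.mem_iUnion₂.1 (ht hy)
  exact hxy (hQg hy) _ (Finset.le_sup hx)

/-- If the contraction group of `g` is closed, then `g P g⁻¹` is relatively open in every compact
subgroup `P` of the contraction group with `g P g⁻¹ ≤ P`. -/
theorem eventually_inv_conj_mem {g : G} (hg : IsClosed (contractionGroup g : Set G))
    {P : Subgroup G} (hP : IsClosed (P : Set G)) (hPg : P ≤ contractionGroup g)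
    (hgP : ∀ x ∈ P, g * x * g⁻¹ ∈ P) :
    ∀ᶠ x in 𝓝 (1 : G), x ∈ P → g⁻¹ * x * g ∈ P := by
  obtain ⟨U, hUc, hUo⟩ := exists_compact_open_subgroup G
  let C₀ := contractionIn g U
  have hC₀cl : IsClosed (C₀ : Set G) := isClosed_contractionIn hg (U.isClosed_of_isOpen hUo)
  have hC₀ : IsCompact (C₀ : Set G) :=
    hUc.of_isClosed_subset hC₀cl (contractionIn_le g U)
  have hC₀ev := eventually_mem_contractionIn hg hUo
  let D := conjSubgroup g C₀
  have hDev : ∀ᶠ x in 𝓝 (1 : G), x ∈ contractionGroup g → x ∈ D := by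
    filter_upwards [(tendsto_inv_conj_one g).eventually hC₀ev] with x hx hxg
    refine mem_conjSubgroup.2 (hx ?_)
    simpa using conj_mem_contractionGroup hxg g⁻¹ (Commute.refl g).inv_left
  have hDfin : D.relIndex C₀ ≠ 0 := by
    have : CompactSpace C₀ := isCompact_iff_compactSpace.1 hC₀
    have ho : IsOpen ((D.subgroupOf C₀ : Subgroup C₀) : Set C₀) := by
      refine Subgroup.isOpen_of_mem_nhds _ (g := 1) ?_
      rw [nhds_subtype]
      refine mem_comap.2 ⟨_, hDev, fun x hx => ?_⟩
      exact Subgroup.mem_subgroupOf.2 (hx x.2.1)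
    have := Subgroup.quotient_finite_of_isOpen (D.subgroupOf C₀) ho
    exact Subgroup.index_ne_zero_of_finite
  -- An increasing chain; the index of the trace of D in A k is bounded by that in C₀, so it
  -- stabilises.
  let A : ℕ → Subgroup G := fun k => conjSubgroup (g ^ k)⁻¹ P ⊓ C₀
  have hA : ∀ k x, x ∈ A k ↔ g ^ k * x * (g ^ k)⁻¹ ∈ P ∧ x ∈ C₀ := fun k x => by
    simp [A, Subgroup.mem_inf, mem_conjSubgroup]
  have hAmono : ∀ k, A k ≤ A (k + 1) := by
    intro k x hx
    rw [hA] at *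
    refine ⟨?_, hx.2⟩
    have := hgP _ hx.1
    rw [pow_succ']
    simpa [mul_assoc] using this
  have hDA : ∀ k, D.relIndex (A k) ≠ 0 := fun k h =>
    hDfin (Subgroup.relIndex_eq_zero_of_le_right inf_le_right h)
  obtain ⟨k₀, hk₀⟩ : ∃ k₀, ∀ k, k₀ ≤ k → D.relIndex (A (k + 1)) ≤ D.relIndex (A k) := by
    have hfin : (Set.range fun k => D.relIndex (A k)).Finite :=
      (Set.finite_Iic (D.relIndex C₀)).subset (by
        rintro _ ⟨k, rfl⟩
        exact Subgroup.relIndex_le_of_le_right inf_le_right hDfin)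
    obtain ⟨_, ⟨k₀, rfl⟩, hmax⟩ := Set.exists_max_image _ id hfin ⟨_, 0, rfl⟩
    have hmono : Monotone fun k => D.relIndex (A k) := monotone_nat_of_le_succ fun k =>
      Subgroup.relIndex_le_of_le_right (hAmono k) (hDA _)
    exact ⟨k₀, fun k hk => (hmax _ ⟨k + 1, rfl⟩).trans (hmono hk)⟩
  -- Stable indices give A (k + 1) = A k · (A (k + 1) ∩ D), and conjugation by g⁻¹ takes the second
  -- factor into A (k + 2). Iterating pushes the error into gⁿC₀g⁻ⁿ, which shrinks to 1, so the
  -- closed A k₀ contains A (k₀ + 1).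
  have hdecomp : ∀ n k : ℕ, k₀ ≤ k → ∀ x ∈ A (k + 1), ∃ a ∈ A k, ∃ d ∈ C₀,
      x = a * (g ^ n * d * (g ^ n)⁻¹) := by
    intro n
    induction n with
    | zero => exact fun k _ x hx => ⟨1, Subgroup.one_mem _, x, ((hA _ _).1 hx).2, by simp⟩
    | succ n ih =>
      intro k hk x hx
      obtain ⟨a, ha, hax⟩ :=
        exists_inv_mul_mem_of_relIndex_eq (hAmono k) (hk₀ k hk) (hDA _) x hx
      have hy := (hA _ _).1 ((A (k + 1)).mul_mem ((A (k + 1)).inv_mem (hAmono k ha)) hx)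
      have hy' : g⁻¹ * (a⁻¹ * x) * g ∈ A (k + 1 + 1) := by
        refine (hA _ _).2 ⟨?_, mem_conjSubgroup.1 hax⟩
        rw [pow_succ]
        simpa [mul_assoc] using hy.1
      obtain ⟨a', ha', d, hd, had⟩ := ih (k + 1) (by omega) _ hy'
      rw [hA] at ha'
      refine ⟨a * (g * a' * g⁻¹), (A k).mul_mem ha ((hA _ _).2 ⟨?_, ?_⟩), d, hd, ?_⟩
      · have := ha'.1
        rw [pow_succ] at this
        simpa [mul_assoc] using this
      · exact conj_mem_contractionIn ha'.2
      · calc x = a * (g * (g⁻¹ * (a⁻¹ * x) * g) * g⁻¹) := by group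
          _ = a * (g * (a' * (g ^ n * d * (g ^ n)⁻¹)) * g⁻¹) := by rw [had]
          _ = a * (g * a' * g⁻¹) * (g ^ (n + 1) * d * (g ^ (n + 1))⁻¹) := by
            rw [pow_succ']
            group
  have hAcl : IsClosed (A k₀ : Set G) := (isClosed_conjSubgroup _ hP).inter hC₀cl
  have hAle : A (k₀ + 1) ≤ A k₀ := by
    intro x hx
    have : x ∈ closure (A k₀ : Set G) := by
      refine mem_closure_iff_nhds.2 fun t ht => ?_
      have hc : Continuous fun z : G => x * z⁻¹ := by fun_prop
      have ht' : (fun z : G => x * z⁻¹) ⁻¹' t ∈ 𝓝 1 := hc.tendsto' 1 x (by simp) ht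
      obtain ⟨n, hn⟩ := eventually_conj_pow_mem hg hC₀ (fun y hy => hy.1) ht'
      obtain ⟨a, ha, d, hd, rfl⟩ := hdecomp n k₀ le_rfl x hx
      refine ⟨a, ?_, ha⟩
      simpa only [Set.mem_preimage, mul_inv_cancel_right] using hn d hd
    rwa [hAcl.closure_eq] at this
  filter_upwards [(tendsto_inv_conj_one (g ^ (k₀ + 1))).eventually hC₀ev] with x hx hxP
  have h1 : (g ^ (k₀ + 1))⁻¹ * x * g ^ (k₀ + 1) ∈ A (k₀ + 1) := by
    refine (hA _ _).2 ⟨by simpa [mul_assoc] using hxP, hx ?_⟩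
    have := conj_mem_contractionGroup (hPg hxP) (g ^ (k₀ + 1))⁻¹
      ((Commute.refl g).pow_left _).inv_left
    simpa using this
  have h2 := ((hA _ _).1 (hAle h1)).1
  have h3 : g ^ k₀ * ((g ^ (k₀ + 1))⁻¹ * x * g ^ (k₀ + 1)) * (g ^ k₀)⁻¹ = g⁻¹ * x * g := by
    group
  rwa [h3] at h2

/-- Were the translates of the commutator outside W infinitely often, two such exponents m ≠ n would
make the m- and n-translates of x congruent modulo W. As the m-translate of x commutes with the
n-translate of y, the n-translate of the commutator would lie in W. -/
theorem commutator_mem_contractionGroup {g : G} {K U : Subgroup G} (hUc : IsCompact (U : Set G))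
    (hK : ∀ n : ℕ, ∀ x ∈ K, g ^ n * x * (g ^ n)⁻¹ ∈ U)
    (hcomm : ∀ n : ℕ, n ≠ 0 → ∀ x ∈ K, ∀ y ∈ K, Commute (g ^ n * x * (g ^ n)⁻¹) y)
    {x y : G} (hx : x ∈ K) (hy : y ∈ K) : x * y * x⁻¹ * y⁻¹ ∈ contractionGroup g := by
  have hpair : ∀ m n : ℕ, m ≠ n →
      Commute (g ^ m * x * (g ^ m)⁻¹) (g ^ n * y * (g ^ n)⁻¹) := by
    have conj : ∀ (k : ℕ) {a b : G}, Commute a b →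
        Commute (g ^ k * a * (g ^ k)⁻¹) (g ^ k * b * (g ^ k)⁻¹) := by
      intro k a b h
      exact h.map (MulAut.conj (g ^ k)).toMonoidHom
    intro m n hmn
    rcases lt_or_gt_of_ne hmn with h | h
    · obtain ⟨d, rfl⟩ := Nat.exists_eq_add_of_lt h
      have := conj m (hcomm (d + 1) (by omega) y hy x hx).symm
      convert this using 1
      rw [add_assoc, pow_add]
      group
    · obtain ⟨d, rfl⟩ := Nat.exists_eq_add_of_lt h
      have := conj n (hcomm (d + 1) (by omega) x hx y hy)
      convert this using 1
      rw [add_assoc, pow_add]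
      group
  rw [mem_contractionGroup, tendsto_def]
  intro O hO
  obtain ⟨W, hWo, hWO, hUW⟩ := exists_open_subgroup_conj_mem hUc hO
  by_contra hcon
  have hinf : {n : ℕ | g ^ n * (x * y * x⁻¹ * y⁻¹) * (g ^ n)⁻¹ ∉ W}.Infinite := by
    refine Nat.frequently_atTop_iff_infinite.1 fun h => hcon ?_
    filter_upwards [h] with n hn
    exact hWO (not_not.1 hn)
  have : CompactSpace U := isCompact_iff_compactSpace.1 hUc
  have ho : IsOpen ((W.subgroupOf U : Subgroup U) : Set U) :=
    hWo.preimage continuous_subtype_val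
  have := Subgroup.quotient_finite_of_isOpen (W.subgroupOf U) ho
  obtain ⟨m, -, n, hn, hmn, heq⟩ := hinf.exists_ne_map_eq_of_mapsTo
    (f := fun n => (QuotientGroup.mk ⟨_, hK n x hx⟩ : U ⧸ W.subgroupOf U))
    (Set.mapsTo_univ _ _) Set.finite_univ
  rw [QuotientGroup.eq, Subgroup.mem_subgroupOf] at heq
  refine hn ?_
  have hc := hpair m n hmn
  have hxmU := hK m x hx
  have hynU := hK n y hy
  set a := g ^ m * x * (g ^ m)⁻¹
  set b := g ^ n * y * (g ^ n)⁻¹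
  set c := g ^ n * x * (g ^ n)⁻¹ with hcdef
  have heq' : a⁻¹ * c ∈ W := heq
  have h1 := hUW a hxmU _ (W.mul_mem heq' (hUW b hynU _ (W.inv_mem heq')))
  have h2 : a⁻¹ * b⁻¹ = b⁻¹ * a⁻¹ := hc.inv_inv.eq
  have h3 : a * (a⁻¹ * c * (b * (a⁻¹ * c)⁻¹ * b⁻¹)) * a⁻¹ = c * b * c⁻¹ * b⁻¹ := by
    calc a * (a⁻¹ * c * (b * (a⁻¹ * c)⁻¹ * b⁻¹)) * a⁻¹
        = c * b * c⁻¹ * a * (b⁻¹ * a⁻¹) := by group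
      _ = c * b * c⁻¹ * a * (a⁻¹ * b⁻¹) := by rw [h2]
      _ = c * b * c⁻¹ * b⁻¹ := by group
  rw [h3] at h1
  convert h1 using 1
  simp only [b, hcdef]
  group

end LocallyCompact

end Contraction

/-! ### The main theorem. -/

theorem mainTheorem10 {G : Type*} [Group G] [TopologicalSpace G] [IsTopologicalGroup G]
    [IsClassS G]
    (hLC : centralizerLattice G ≠ {StructureLattice.zero G, StructureLattice.infty G}) :
    ∃ g : G, ¬ IsClosed (contractionGroup g : Set G) := by
  have hq := quasiCentralizer_top (G := G)
  have ha := noAbelianLocallyNormal (G := G)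
  obtain ⟨R₀, hR₀, h0, h1⟩ := exists_isBicommutant_ne hLC
  obtain ⟨U, g, δ, hUc, hUo, hδ, hle, hnle, hU⟩ := exists_skewering hR₀ h0 h1
  refine ⟨g, fun hg => ?_⟩
  have hgδ := hδ.conj g
  have hgδ' := hgδ.isBicommutant_quasiCentralizer hq ha
  -- The relative complement of gδg⁻¹ in δ, non-trivial because the inclusion is strict.
  let β := δ ⊓ quasiCentralizer (conjSubgroup g δ)
  have hβ : IsBicommutant β := hδ.inf hgδ'
  have hβ0 : β ≠ ⊥ := fun h => hnle (hδ.le_of_inf_quasiCentralizer_eq_bot hq ha hgδ h)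
  let K := β ⊓ U
  have hUcl := U.isClosed_of_isOpen hUo
  have hKln : IsLocallyNormal K := hβ.toIsLocallyNormal.inf (.of_isOpen hUo)
  have horb : ∀ n : ℕ, ∀ x ∈ K, g ^ n * x * (g ^ n)⁻¹ ∈ δ ∧ g ^ n * x * (g ^ n)⁻¹ ∈ U := by
    intro n x hx
    induction n with
    | zero => simpa using ⟨hx.1.1, hx.2⟩
    | succ n ih =>
      have h2 : g ^ (n + 1) * x * (g ^ (n + 1))⁻¹ = g * (g ^ n * x * (g ^ n)⁻¹) * g⁻¹ := by
        rw [pow_succ']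
        group
      rw [h2]
      exact ⟨hle (conj_mem_conjSubgroup.2 ih.1), (hU _ ih.1).1 ih.2⟩
  have hcomm : ∀ n : ℕ, n ≠ 0 → ∀ x ∈ K, ∀ y ∈ K, Commute (g ^ n * x * (g ^ n)⁻¹) y := by
    intro n hn x hx y hy
    obtain ⟨n, rfl⟩ := Nat.exists_eq_succ_of_ne_zero hn
    refine hgδ.commute hq ha ?_ hy.1.2
    have h2 : g ^ (n + 1) * x * (g ^ (n + 1))⁻¹ = g * (g ^ n * x * (g ^ n)⁻¹) * g⁻¹ := by
      rw [pow_succ']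
      group
    rw [h2]
    exact conj_mem_conjSubgroup.2 (horb n x hx).1
  let B : Subgroup G := (⁅K, K⁆ : Subgroup G).topologicalClosure
  have hBcl : IsClosed (B : Set G) := Subgroup.isClosed_topologicalClosure _
  have hKcl : IsClosed (K : Set G) := hKln.isClosed
  have hBK : B ≤ K := Subgroup.topologicalClosure_minimal _
    (Subgroup.commutator_le.2 fun x hx y hy => by
      rw [commutatorElement_def]
      exact K.mul_mem (K.mul_mem (K.mul_mem hx hy) (K.inv_mem hx)) (K.inv_mem hy)) hKcl
  have hBg : B ≤ contractionGroup g := Subgroup.topologicalClosure_minimal _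
    (Subgroup.commutator_le.2 fun x hx y hy => by
      rw [commutatorElement_def]
      exact commutator_mem_contractionGroup hUc (fun n x hx => (horb n x hx).2) hcomm hx hy) hg
  have hBln : IsLocallyNormal B := by
    refine ⟨hBcl, ?_⟩
    filter_upwards [hKln.eventually_conj_mem] with u hu
    have hle : B ≤ conjSubgroup u⁻¹ B := by
      refine Subgroup.topologicalClosure_minimal _ (Subgroup.commutator_le.2 fun x hx y hy => ?_)
        (isClosed_conjSubgroup _ hBcl)
      refine mem_conjSubgroup.2 (Subgroup.le_topologicalClosure _ ?_)
      rw [inv_inv]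
      have := Subgroup.commutator_mem_commutator (hu x hx) (hu y hy)
      rwa [← conjugate_commutatorElement] at this
    intro x hx
    simpa using mem_conjSubgroup.1 (hle hx)
  -- Heuristically a product of commuting copies of B shifted by g, so that gPg⁻¹ omits the factor
  -- B.
  let P : Subgroup G := (⨆ n : ℕ, conjSubgroup (g ^ n) B).topologicalClosure
  have hPcl : IsClosed (P : Set G) := Subgroup.isClosed_topologicalClosure _
  have hPle : ∀ H : Subgroup G, IsClosed (H : Set G) →
      (∀ n : ℕ, ∀ x ∈ B, g ^ n * x * (g ^ n)⁻¹ ∈ H) → P ≤ H := by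
    intro H hH h
    refine Subgroup.topologicalClosure_minimal _ (iSup_le fun n x hx => ?_) hH
    simpa [mul_assoc] using h n _ (mem_conjSubgroup.1 hx)
  have hmemP : ∀ n : ℕ, ∀ x ∈ B, g ^ n * x * (g ^ n)⁻¹ ∈ P := fun n x hx =>
    Subgroup.le_topologicalClosure _ (Subgroup.mem_iSup_of_mem n (conj_mem_conjSubgroup.2 hx))
  have hPg : P ≤ contractionGroup g := hPle _ hg fun n x hx =>
    conj_mem_contractionGroup (hBg hx) _ ((Commute.refl g).pow_left n)
  have hshift : ∀ (H : Subgroup G), IsClosed (H : Set G) →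
      (∀ n : ℕ, ∀ x ∈ B, g ^ (n + 1) * x * (g ^ (n + 1))⁻¹ ∈ H) → ∀ x ∈ P, g * x * g⁻¹ ∈ H := by
    intro H hH h x hx
    have : P ≤ conjSubgroup g⁻¹ H := by
      refine hPle _ (isClosed_conjSubgroup _ hH) fun n x hx => mem_conjSubgroup.2 ?_
      have := h n x hx
      rw [pow_succ'] at this
      simpa [mul_assoc] using this
    simpa using mem_conjSubgroup.1 (this hx)
  have hgP : ∀ x ∈ P, g * x * g⁻¹ ∈ P := hshift P hPcl fun n => hmemP (n + 1)
  have hcent : ∀ x ∈ P, g * x * g⁻¹ ∈ Subgroup.centralizer (B : Set G) := by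
    refine hshift _ (Set.isClosed_centralizer _) fun n x hx => ?_
    refine Subgroup.mem_centralizer_iff.2 fun b hb => ?_
    exact (hcomm (n + 1) (Nat.succ_ne_zero n) x (hBK hx) b (hBK hb)).symm.eq
  have hZ : B ⊓ Subgroup.centralizer (B : Set G) = ⊥ := by
    refine ha _ ⟨hBcl.inter (Set.isClosed_centralizer _), ?_⟩ fun x hx y hy =>
      Subgroup.mem_centralizer_iff.1 hy.2 x hx.1
    filter_upwards [hBln.eventually_conj_mem, hBln.eventually_conjSubgroup_eq] with u hu hu'
    refine fun x hx => ⟨hu x hx.1, Subgroup.mem_centralizer_iff.2 fun b hb => ?_⟩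
    have hb' : u⁻¹ * b * u ∈ B := by
      rw [← hu'] at hb
      exact mem_conjSubgroup.1 hb
    have := Subgroup.mem_centralizer_iff.1 hx.2 _ hb'
    calc b * (u * x * u⁻¹) = u * (u⁻¹ * b * u * x) * u⁻¹ := by group
      _ = u * (x * (u⁻¹ * b * u)) * u⁻¹ := by rw [this]
      _ = u * x * u⁻¹ * b := by group
  -- Elements of B near 1 lie in gPg⁻¹, hence in the trivial centre of B.
  have hB0 : B = ⊥ := by
    refine hBln.eq_bot_of_eventually hq ?_
    filter_upwards [eventually_inv_conj_mem hg hPcl hPg hgP] with x hx hxB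
    have h2 := hcent _ (hx (by simpa using hmemP 0 x hxB))
    have h3 : x ∈ B ⊓ Subgroup.centralizer (B : Set G) := ⟨hxB, by simpa [mul_assoc] using h2⟩
    rwa [hZ] at h3
  have hK0 : K = ⊥ := by
    refine ha K hKln fun x hx y hy => ?_
    have := Subgroup.le_topologicalClosure _ (Subgroup.commutator_mem_commutator hx hy)
    change _ ∈ B at this
    rw [hB0, Subgroup.mem_bot, commutatorElement_eq_one_iff_mul_comm] at this
    exact this
  exact hβ0 (hβ.eq_bot_of_inf_eq_bot hq hUo hK0)
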